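/- Let $\mathbf{f}=(f_1,f_2,f_3)$ be a triple of power series in $\mathbb{C}[[t]]$ without constant term. Its value semigroup is the set of all $t$-adic valuations of nonzero elements of the image of $\mathbb{C}[[x_1,x_2,x_3]]\to\mathbb{C}[[t]]$, $x_i\mapsto f_i(t)$. For $m\geq 1$ let ${\rm S}_{\rm gen}={\rm S}_{\rm gen}(m)$ denote the value semigroup of a generic triple with $v_t(f_1)=2m$, $v_t(f_2)=2m+2$, $v_t(f_3)=2m+4$; that is, the semigroup common to all such triples whose coefficients lie outside the zero locus of some nonzero polynomial in the coefficients $[t^{v_t(f_i)+j}]f_i$ ($1\le i\le 3$, $j\geq 0$). Let $M^3_d$ be the space of nondegenerate morphisms $\mathbb{P}^1\to\mathbb{P}^3$ of degree $d$ over $\mathbb{C}$, each identified with the set of coefficients of its four homogeneous parameterizing polynomials, and let $M^3_{d,g;{\rm S}}\subset M^3_d$ be the locus of those morphisms that are injective and whose image has arithmetic genus $g$ and exactly one singular point, with value semigroup ${\rm S}$ there. For every integer $m\geq 9$, the generic value semigroup ${\rm S}_{\rm gen}$ is well defined (it exists and is unique) and has finite complement in $\mathbb{N}$, and, with $g=\#(\mathbb{N}\setminus{\rm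 S}_{\rm gen})$, the Severi variety $M^3_{d,g;{\rm S}_{\rm gen}}$ has codimension strictly less than $g$ in $M^3_d$ for all $d\gg g$ (that is, for all $d\geq D(g)$, where $D(g)$ depends only on $g$); in particular it is nonempty for such $d$, the codimension of the empty set being $\infty$. -/

import Mathlib

namespace Severi

noncomputable section

/-- The set of valuations `v_t(φ(G))` of the nonzero elements of the image of the ring map
`φ : ℂ[[x₁,…,xₙ]] → ℂ[[t]]`, `xᵢ ↦ fᵢ(t)`, for power series `fᵢ` without constant term. -/
def valueSemigroup {n : ℕ} (f : Fin n → PowerSeries ℂ) : Set ℕ :=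
  {v : ℕ | ∃ G : MvPowerSeries (Fin n) ℂ,
    PowerSeries.order (MvPowerSeries.subst f G : PowerSeries ℂ) = (v : ℕ∞)}

/-- `S` is the value semigroup of a generic parameterization `f = (f₁,…,fₙ)` with
`v_t(fᵢ) = kᵢ`: writing `fᵢ = t ^ kᵢ * aᵢ(t)` with `aᵢ(0) ≠ 0`, every such `f` outside the
vanishing locus of some nonzero polynomial in the coefficients of the `aᵢ` has value
semigroup `S`. -/
def IsGenericValueSemigroup {n : ℕ} (k : Fin n → ℕ) (S : Set ℕ) : Prop :=
  ∃ Φ : MvPolynomial (Fin n × ℕ) ℂ, Φ ≠ 0 ∧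
    ∀ a : Fin n → PowerSeries ℂ,
      (∀ i, PowerSeries.constantCoeff (a i) ≠ 0) →
      MvPolynomial.eval (fun x : Fin n × ℕ => PowerSeries.coeff x.2 (a x.1)) Φ ≠ 0 →
      valueSemigroup (fun i => PowerSeries.X ^ k i * a i) = S

/-- The affine space of `(n+1)`-tuples of binary forms of degree `d`, given by their
coefficients: `c` stands for the forms `Fᵢ(s, u) = ∑ⱼ c (i, j) s ^ j u ^ (d - j)`. -/
abbrev Forms (n d : ℕ) : Type := Fin (n + 1) × Fin (d + 1) → ℂ

/-- Expansion of the forms `Fᵢ` at a point `p` of `ℙ¹ = ℂ ∪ {∞}`: it is `Fᵢ(z + t, 1)` at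
`p = z = (z : 1)` and `Fᵢ(1, t)` at `p = ∞ = (1 : 0)`. -/
def expansion {n d : ℕ} (c : Forms n d) (p : OnePoint ℂ) (i : Fin (n + 1)) : PowerSeries ℂ :=
  p.elim
    (∑ j : Fin (d + 1), PowerSeries.C (c (i, j)) * PowerSeries.X ^ (d - (j : ℕ)))
    (fun z => ∑ j : Fin (d + 1),
      PowerSeries.C (c (i, j)) * (PowerSeries.C z + PowerSeries.X) ^ (j : ℕ))

/-- The homogeneous coordinates of the image of `p`. -/
def value {n d : ℕ} (c : Forms n d) (p : OnePoint ℂ) : Fin (n + 1) → ℂ :=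
  fun i => PowerSeries.constantCoeff (expansion c p i)

/-- The space `M^n_d` of nondegenerate morphisms `ℙ¹ → ℙⁿ` of degree `d`, each identified with
the coefficients of its parameterizing forms: these have no common zero, and the image lies in
no hyperplane. -/
def maps (n d : ℕ) : Set (Forms n d) :=
  {c | (∀ p : OnePoint ℂ, value c p ≠ 0) ∧
    LinearIndependent ℂ (fun (i : Fin (n + 1)) (j : Fin (d + 1)) => c (i, j))}

/-- The morphism `ℙ¹ → ℙⁿ` given by a point of `M^n_d`. -/
def toMap {n d : ℕ} (c : Forms n d) (hc : c ∈ maps n d) (p : OnePoint ℂ) :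
    Projectivization ℂ (Fin (n + 1) → ℂ) :=
  Projectivization.mk ℂ (value c p) (hc.1 p)

/-- Affine coordinates of the morphism near `p`, in the chart where the `j`-th homogeneous
coordinate does not vanish, centred at the image of `p`. -/
def germ {n d : ℕ} (c : Forms n d) (p : OnePoint ℂ) (j : Fin (n + 1)) (i : Fin n) :
    PowerSeries ℂ :=
  expansion c p (j.succAbove i) * (expansion c p j)⁻¹
    - PowerSeries.C (value c p (j.succAbove i) * (value c p j)⁻¹)

/-- The value semigroup of the branch of the morphism at `p`. It does not depend on the affine
chart `j` around the image of `p`. -/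
def valueSemigroupAt {n d : ℕ} (c : Forms n d) (p : OnePoint ℂ) : Set ℕ :=
  {v | ∃ j : Fin (n + 1), value c p j ≠ 0 ∧ v ∈ valueSemigroup (germ c p j)}

/-- The arithmetic genus of the image of an injective morphism, i.e. of a rational curve all of
whose points are unibranch: the sum of the local genera `δ_P = #(ℕ \ S_P)`. -/
def arithGenus {n d : ℕ} (c : Forms n d) : ℕ∞ :=
  ∑ᶠ p : OnePoint ℂ, (valueSemigroupAt c p)ᶜ.encard

/-- `M^n_{d,g;S}`: the unicuspidal rational curves of arithmetic genus `g` whose cusp has value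
semigroup `S`. The morphism is injective (all points of the image are unibranch), and exactly one
point of the image is singular (the smooth points are those with value semigroup `ℕ`). -/
def severi (n d g : ℕ) (S : Set ℕ) : Set (Forms n d) :=
  {c | ∃ hc : c ∈ maps n d, Function.Injective (toMap c hc) ∧ arithGenus c = (g : ℕ∞) ∧
    ∃ p : OnePoint ℂ, valueSemigroupAt c p = S ∧ S ≠ Set.univ ∧
      ∀ q : OnePoint ℂ, q ≠ p → valueSemigroupAt c q = Set.univ}

/-- The codimension of (the Zariski closure of) `V` in (the Zariski closure of) `M`, for subsets
`V ⊆ M` of an affine space over `ℂ`: the height, in the coordinate ring of the closure of `M`, of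
the ideal of the functions that vanish on `V`. It is the minimum of the codimensions of the
irreducible components, and it is `⊤` if `V` is empty. -/
def codim {σ : Type*} (V M : Set (σ → ℂ)) : ℕ∞ :=
  ((MvPolynomial.vanishingIdeal ℂ V).map
    (Ideal.Quotient.mk (MvPolynomial.vanishingIdeal ℂ M))).height

end

end Severi

namespace Severi

noncomputable section

theorem hasSubst_of_constantCoeff {n : ℕ} {f : Fin n → PowerSeries ℂ}
    (hf : ∀ i, PowerSeries.constantCoeff (f i) = 0) : MvPowerSeries.HasSubst f :=
  MvPowerSeries.hasSubst_of_constantCoeff_zero hf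

/-- Substitution enlarges no value semigroup. -/
theorem valueSemigroup_subset_of_subst {n k : ℕ} {f : Fin n → PowerSeries ℂ}
    {g : Fin k → PowerSeries ℂ} (hf : ∀ i, PowerSeries.constantCoeff (f i) = 0)
    (G : Fin k → MvPowerSeries (Fin n) ℂ) (hG : ∀ i, MvPowerSeries.constantCoeff (G i) = 0)
    (hg : ∀ i, g i = MvPowerSeries.subst f (G i)) :
    valueSemigroup g ⊆ valueSemigroup f := by
  rintro v ⟨H, hH⟩
  refine ⟨MvPowerSeries.subst G H, ?_⟩
  have h := MvPowerSeries.subst_comp_subst_apply (R := ℂ)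
    (MvPowerSeries.hasSubst_of_constantCoeff_zero hG) (hasSubst_of_constantCoeff hf) H
  rw [h, ← hH]
  congr 2
  funext i
  exact (hg i).symm

theorem zero_mem_valueSemigroup {n : ℕ} {f : Fin n → PowerSeries ℂ}
    (hf : ∀ i, PowerSeries.constantCoeff (f i) = 0) : 0 ∈ valueSemigroup f := by
  refine ⟨1, ?_⟩
  rw [← MvPowerSeries.coe_substAlgHom (hasSubst_of_constantCoeff hf), map_one]
  exact PowerSeries.order_one

theorem add_mem_valueSemigroup {n : ℕ} {f : Fin n → PowerSeries ℂ}
    (hf : ∀ i, PowerSeries.constantCoeff (f i) = 0) {v w : ℕ}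
    (hv : v ∈ valueSemigroup f) (hw : w ∈ valueSemigroup f) : v + w ∈ valueSemigroup f := by
  obtain ⟨G, hG⟩ := hv
  obtain ⟨H, hH⟩ := hw
  refine ⟨G * H, ?_⟩
  rw [MvPowerSeries.subst_mul (hasSubst_of_constantCoeff hf)]
  refine (PowerSeries.order_mul _ _).trans ?_
  rw [hG, hH]
  push_cast
  rfl

theorem mul_mem_valueSemigroup {n : ℕ} {f : Fin n → PowerSeries ℂ}
    (hf : ∀ i, PowerSeries.constantCoeff (f i) = 0) {v : ℕ}
    (hv : v ∈ valueSemigroup f) (k : ℕ) : k * v ∈ valueSemigroup f := by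
  induction k with
  | zero => simpa using zero_mem_valueSemigroup hf
  | succ k ih => rw [add_mul, one_mul]; exact add_mem_valueSemigroup hf ih hv

theorem mem_valueSemigroup_of_order {n : ℕ} {f : Fin n → PowerSeries ℂ}
    (hf : ∀ i, PowerSeries.constantCoeff (f i) = 0) {v : ℕ} (i : Fin n)
    (hv : PowerSeries.order (f i) = v) : v ∈ valueSemigroup f :=
  ⟨MvPowerSeries.X i, by rw [MvPowerSeries.subst_X (hasSubst_of_constantCoeff hf), hv]⟩

theorem valueSemigroup_eq_univ {n : ℕ} {f : Fin n → PowerSeries ℂ}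
    (hf : ∀ i, PowerSeries.constantCoeff (f i) = 0) (i : Fin n)
    (h : PowerSeries.coeff 1 (f i) ≠ 0) : valueSemigroup f = Set.univ := by
  have h1 : 1 ∈ valueSemigroup f := by
    refine mem_valueSemigroup_of_order hf i (PowerSeries.order_eq_nat.2 ⟨h, ?_⟩)
    intro j hj
    obtain rfl : j = 0 := by omega
    simpa using hf i
  refine Set.eq_univ_of_forall fun v => ?_
  simpa using mul_mem_valueSemigroup hf h1 v

/-- The monomial `f ^ e` in the power series `f i`. -/
def seriesMonomial {n : ℕ} {R : Type*} [CommRing R] (f : Fin n → PowerSeries R)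
    (e : Fin n →₀ ℕ) : PowerSeries R := ∏ i, f i ^ e i

theorem coeff_subst_eq_sum {n : ℕ} {f : Fin n → PowerSeries ℂ}
    (hf : ∀ i, PowerSeries.constantCoeff (f i) = 0) {N : ℕ} {T : Finset (Fin n →₀ ℕ)}
    (hT : ∀ e, e ∉ T → ∀ j < N, PowerSeries.coeff j (seriesMonomial f e) = 0)
    (G : MvPowerSeries (Fin n) ℂ) {j : ℕ} (hj : j < N) :
    PowerSeries.coeff j (MvPowerSeries.subst f G : PowerSeries ℂ) =
      ∑ e ∈ T, MvPowerSeries.coeff e G * PowerSeries.coeff j (seriesMonomial f e) := by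
  have hm : ∀ e : Fin n →₀ ℕ, (e.prod fun s k => f s ^ k) = seriesMonomial f e := fun e =>
    Finsupp.prod_fintype e _ fun i => pow_zero (f i)
  have h := MvPowerSeries.coeff_subst (hasSubst_of_constantCoeff hf) G (Finsupp.single () j)
  refine h.trans ?_
  rw [finsum_eq_sum_of_support_subset (s := T)]
  · refine Finset.sum_congr rfl fun e _ => ?_
    rw [smul_eq_mul]
    congr 1
    exact congrArg (PowerSeries.coeff j) (hm e)
  · intro e he
    by_contra hne
    refine he ?_
    have := hT e hne j hj
    rw [← hm e] at this
    have h0 : (MvPowerSeries.coeff (Finsupp.single () j)) (e.prod fun s k => f s ^ k) = 0 := this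
    change _ • (MvPowerSeries.coeff (Finsupp.single () j)) (e.prod fun s k => f s ^ k) = 0
    rw [h0, smul_zero]

/-- Values below `N` are detected by the linear combinations of the monomials in `T`, if all
other monomials have order at least `N`. -/
theorem mem_valueSemigroup_iff {n : ℕ} {f : Fin n → PowerSeries ℂ}
    (hf : ∀ i, PowerSeries.constantCoeff (f i) = 0) {N : ℕ} {T : Finset (Fin n →₀ ℕ)}
    (hT : ∀ e, e ∉ T → ∀ j < N, PowerSeries.coeff j (seriesMonomial f e) = 0)
    {v : ℕ} (hv : v < N) :
    v ∈ valueSemigroup f ↔ ∃ x : (Fin n →₀ ℕ) → ℂ,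
      (∀ j < v, ∑ e ∈ T, x e * PowerSeries.coeff j (seriesMonomial f e) = 0) ∧
      ∑ e ∈ T, x e * PowerSeries.coeff v (seriesMonomial f e) ≠ 0 := by
  constructor
  · rintro ⟨G, hG⟩
    obtain ⟨h1, h2⟩ := PowerSeries.order_eq_nat.1 hG
    refine ⟨fun e => MvPowerSeries.coeff e G, fun j hj => ?_, ?_⟩
    · rw [← coeff_subst_eq_sum hf hT G (hj.trans hv), h2 j hj]
    · rwa [← coeff_subst_eq_sum hf hT G hv]
  · rintro ⟨x, h1, h2⟩
    let G : MvPowerSeries (Fin n) ℂ := fun e => x e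
    have hG : ∀ e, MvPowerSeries.coeff e G = x e := fun e => rfl
    refine ⟨G, PowerSeries.order_eq_nat.2 ⟨?_, fun j hj => ?_⟩⟩
    · rw [coeff_subst_eq_sum hf hT G hv]
      simpa only [hG] using h2
    · rw [coeff_subst_eq_sum hf hT G (hj.trans hv)]
      simpa only [hG] using h1 j hj

/-- There are at most as many values below `N` as monomials of order less than `N`. -/
theorem card_le_of_subset_valueSemigroup {n : ℕ} {f : Fin n → PowerSeries ℂ}
    (hf : ∀ i, PowerSeries.constantCoeff (f i) = 0) {N : ℕ} {T : Finset (Fin n →₀ ℕ)}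
    (hT : ∀ e, e ∉ T → ∀ j < N, PowerSeries.coeff j (seriesMonomial f e) = 0)
    (s : Finset ℕ) (hs : ∀ v ∈ s, v < N ∧ v ∈ valueSemigroup f) : s.card ≤ T.card := by
  have hx : ∀ v : s, ∃ x : (Fin n →₀ ℕ) → ℂ,
      (∀ j < v.1, ∑ e ∈ T, x e * PowerSeries.coeff j (seriesMonomial f e) = 0) ∧
      ∑ e ∈ T, x e * PowerSeries.coeff v.1 (seriesMonomial f e) ≠ 0 := fun v =>
    (mem_valueSemigroup_iff hf hT (hs v.1 v.2).1).1 (hs v.1 v.2).2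
  choose x hx0 hx1 using hx
  have hli : LinearIndependent ℂ (fun (v : s) (e : T) => x v e.1) := by
    rw [Fintype.linearIndependent_iff]
    intro c hc
    by_contra hne
    push Not at hne
    obtain ⟨v, hv, hmin⟩ := exists_minimal_of_wellFoundedLT (fun v : s => c v ≠ 0) hne
    refine hx1 v ?_
    have hcomb : ∑ w : s, c w * ∑ e ∈ T, x w e * PowerSeries.coeff v.1 (seriesMonomial f e) = 0 := by
      simp_rw [Finset.mul_sum]
      rw [Finset.sum_comm]
      refine Finset.sum_eq_zero fun e he => ?_
      have := congrFun hc ⟨e, he⟩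
      simp only [Finset.sum_apply, Pi.smul_apply, smul_eq_mul, Pi.zero_apply] at this
      simp_rw [← mul_assoc]
      rw [← Finset.sum_mul, this, zero_mul]
    rw [Finset.sum_eq_single v] at hcomb
    · exact (mul_eq_zero.1 hcomb).resolve_left hv
    · intro w _ hw
      by_cases hcw : c w = 0
      · rw [hcw, zero_mul]
      · have hvw : v.1 < w.1 :=
          lt_of_le_of_ne (not_lt.1 fun h => absurd (hmin hcw h.le) (not_le.2 h))
            fun h => hw (Subtype.ext h.symm)
        rw [hx0 w v.1 hvw, mul_zero]
    · simp
  simpa using hli.fintype_card_le_finrank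

/-- Over a domain, a column of a matrix becomes, after multiplication with a nonzero scalar, a
combination of the previous columns, unless a row vector separates it from them. -/
theorem exists_separating_or_dependent {R ι : Type*} [CommRing R] [IsDomain R] [Fintype ι]
    (M : ι → ℕ → R) (v : ℕ) : ∃ D : R, D ≠ 0 ∧
      ((∃ x : ι → R, (∀ j < v, ∑ e, x e * M e j = 0) ∧ ∑ e, x e * M e v = D) ∨
        ∃ μ : ℕ → R, ∀ e, D * M e v = ∑ j ∈ Finset.range v, μ j * M e j) := by
  classical
  let K := FractionRing R
  let col : ℕ → ι → K := fun j e => algebraMap R K (M e j)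
  have hinj : Function.Injective (algebraMap R K) := IsFractionRing.injective R K
  by_cases hmem : col v ∈ Submodule.span K (col '' (Finset.range v : Set ℕ))
  · obtain ⟨c', hc'⟩ := (Submodule.mem_span_image_finset_iff_exists_fun K).1 hmem
    obtain ⟨c, hc⟩ : ∃ c : ℕ → K, ∑ j ∈ Finset.range v, c j • col j = col v := by
      refine ⟨fun j => if h : j ∈ Finset.range v then c' ⟨j, h⟩ else 0, ?_⟩
      rw [← hc', ← Finset.sum_coe_sort]
      exact Finset.sum_congr rfl fun j _ => by beta_reduce; rw [dif_pos j.2]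
    obtain ⟨⟨b, hb⟩, hbc⟩ :=
      IsLocalization.exist_integer_multiples_of_finset (nonZeroDivisors R)
        ((Finset.range v).image c)
    have hint : ∀ j, ∃ r : R, j ∈ Finset.range v → algebraMap R K r = algebraMap R K b * c j := by
      intro j
      by_cases hj : j ∈ Finset.range v
      · obtain ⟨r, hr⟩ := hbc (c j) (Finset.mem_image_of_mem c hj)
        exact ⟨r, fun _ => by rw [hr, Algebra.smul_def]⟩
      · exact ⟨0, fun h => absurd h hj⟩
    choose μ hμ using hint
    refine ⟨b, nonZeroDivisors.ne_zero hb, Or.inr ⟨μ, fun e => hinj ?_⟩⟩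
    have he := congrFun hc e
    simp only [Finset.sum_apply, Pi.smul_apply, smul_eq_mul] at he
    rw [map_mul, map_sum]
    change algebraMap R K b * col v e = _
    rw [← he, Finset.mul_sum]
    refine Finset.sum_congr rfl fun j hj => ?_
    rw [map_mul, hμ j hj, mul_assoc]
  · obtain ⟨φ, hφ, hker⟩ := Submodule.exists_le_ker_of_notMem hmem
    let y : ι → K := fun e => φ (Pi.single e 1)
    have hy : ∀ j, φ (col j) = ∑ e, y e * col j e := by
      intro j
      conv_lhs => rw [pi_eq_sum_univ' (col j), map_sum]
      refine Finset.sum_congr rfl fun e _ => ?_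
      rw [map_smul, smul_eq_mul, mul_comm]
    obtain ⟨⟨b, hb⟩, hbc⟩ :=
      IsLocalization.exist_integer_multiples_of_finset (nonZeroDivisors R)
        (Finset.univ.image y)
    have hint : ∀ e, ∃ r : R, algebraMap R K r = algebraMap R K b * y e := by
      intro e
      obtain ⟨r, hr⟩ := hbc (y e) (Finset.mem_image_of_mem y (Finset.mem_univ e))
      exact ⟨r, by rw [hr, Algebra.smul_def]⟩
    choose x hx using hint
    have hxy : ∀ j, algebraMap R K (∑ e, x e * M e j) = algebraMap R K b * φ (col j) := by
      intro j
      rw [hy, map_sum, Finset.mul_sum]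
      refine Finset.sum_congr rfl fun e _ => ?_
      rw [map_mul, hx, mul_assoc]
    have hb0 : algebraMap R K b ≠ 0 := by
      rw [Ne, map_eq_zero_iff _ hinj]
      exact nonZeroDivisors.ne_zero hb
    refine ⟨∑ e, x e * M e v, fun h => ?_, Or.inl ⟨x, fun j hj => hinj ?_, rfl⟩⟩
    · have := hxy v
      rw [h, map_zero] at this
      exact (mul_ne_zero hb0 hφ) this.symm
    · rw [hxy, map_zero]
      have : φ (col j) = 0 :=
        hker (Submodule.subset_span ⟨j, by simpa using hj, rfl⟩)
      rw [this, mul_zero]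

theorem X_pow_dvd_seriesMonomial {n : ℕ} {R : Type*} [CommRing R] {f : Fin n → PowerSeries R}
    {k : Fin n → ℕ} (hk : ∀ i, PowerSeries.X ^ k i ∣ f i) (e : Fin n →₀ ℕ) :
    PowerSeries.X ^ (∑ i, k i * e i) ∣ seriesMonomial f e := by
  rw [← Finset.prod_pow_eq_pow_sum]
  refine Finset.prod_dvd_prod_of_dvd _ _ fun i _ => ?_
  rw [pow_mul]
  exact pow_dvd_pow_of_dvd (hk i) _

theorem coeff_seriesMonomial_eq_zero {n : ℕ} {R : Type*} [CommRing R] {f : Fin n → PowerSeries R}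
    {k : Fin n → ℕ} (hk : ∀ i, PowerSeries.X ^ k i ∣ f i) (e : Fin n →₀ ℕ) {j : ℕ}
    (hj : j < ∑ i, k i * e i) : PowerSeries.coeff j (seriesMonomial f e) = 0 :=
  PowerSeries.X_pow_dvd_iff.1 (X_pow_dvd_seriesMonomial hk e) j hj

theorem constantCoeff_X_pow_mul {k : ℕ} (hk : k ≠ 0) (a : PowerSeries ℂ) :
    PowerSeries.constantCoeff (PowerSeries.X ^ k * a) = 0 := by
  rw [map_mul, map_pow, PowerSeries.constantCoeff_X, zero_pow hk, zero_mul]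

/-- The evaluation of polynomials in the coefficients of `n` power series. -/
def coeffEval {n : ℕ} (a : Fin n → PowerSeries ℂ) : MvPolynomial (Fin n × ℕ) ℂ →+* ℂ :=
  MvPolynomial.eval fun x => PowerSeries.coeff x.2 (a x.1)

/-- The power series `X ^ k i * a i` whose factors `a i` have indeterminate coefficients. -/
def universalSeries {n : ℕ} (k : Fin n → ℕ) (i : Fin n) :
    PowerSeries (MvPolynomial (Fin n × ℕ) ℂ) :=
  PowerSeries.X ^ k i * PowerSeries.mk fun j => MvPolynomial.X (i, j)

theorem map_universalSeries {n : ℕ} (k : Fin n → ℕ) (a : Fin n → PowerSeries ℂ) (i : Fin n) :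
    PowerSeries.map (coeffEval a) (universalSeries k i) = PowerSeries.X ^ k i * a i := by
  rw [universalSeries, map_mul, map_pow, PowerSeries.map_X]
  congr 1
  ext j
  simp [coeffEval]

theorem coeffEval_coeff_seriesMonomial {n : ℕ} (k : Fin n → ℕ) (a : Fin n → PowerSeries ℂ)
    (e : Fin n →₀ ℕ) (j : ℕ) :
    coeffEval a (PowerSeries.coeff j (seriesMonomial (universalSeries k) e)) =
      PowerSeries.coeff j (seriesMonomial (fun i => PowerSeries.X ^ k i * a i) e) := by
  rw [← PowerSeries.coeff_map]
  congr 1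
  simp_rw [seriesMonomial, map_prod, map_pow, map_universalSeries]

theorem exists_generic_mem_iff {n : ℕ} {k : Fin n → ℕ} (hk : ∀ i, k i ≠ 0) (v : ℕ) :
    ∃ D : MvPolynomial (Fin n × ℕ) ℂ, D ≠ 0 ∧ ∃ P : Prop, ∀ a : Fin n → PowerSeries ℂ,
      coeffEval a D ≠ 0 → (v ∈ valueSemigroup (fun i => PowerSeries.X ^ k i * a i) ↔ P) := by
  classical
  let T : Finset (Fin n →₀ ℕ) := Finset.Iic (Finsupp.equivFunOnFinite.symm fun _ => v)
  have hT : ∀ a : Fin n → PowerSeries ℂ, ∀ e, e ∉ T → ∀ j < v + 1, PowerSeries.coeff j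
      (seriesMonomial (fun i => PowerSeries.X ^ k i * a i) e) = 0 := by
    intro a e he j hj
    refine coeff_seriesMonomial_eq_zero (k := k) (fun i => Dvd.intro _ rfl) e ?_
    have : ∃ i, v < e i := by
      by_contra! h
      exact he (Finset.mem_Iic.2 fun i => by simpa using h i)
    obtain ⟨i, hi⟩ := this
    calc j < e i := by omega
      _ ≤ k i * e i := Nat.le_mul_of_pos_left _ (Nat.pos_of_ne_zero (hk i))
      _ ≤ _ := Finset.single_le_sum (f := fun i => k i * e i) (fun _ _ => Nat.zero_le _)
        (Finset.mem_univ i)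
  have hf : ∀ a : Fin n → PowerSeries ℂ, ∀ i,
      PowerSeries.constantCoeff (PowerSeries.X ^ k i * a i) = 0 := fun a i =>
    constantCoeff_X_pow_mul (hk i) (a i)
  have hmem := fun a => mem_valueSemigroup_iff (hf a) (hT a) (Nat.lt_succ_self v)
  obtain ⟨D, hD, h⟩ := exists_separating_or_dependent
    (fun (e : T) j => PowerSeries.coeff j (seriesMonomial (universalSeries k) e.1)) v
  rcases h with ⟨x, hx0, hx1⟩ | ⟨μ, hμ⟩
  · refine ⟨D, hD, True, fun a ha => ?_⟩
    rw [hmem a, iff_true]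
    have key : ∀ j, ∑ e ∈ T, (if h : e ∈ T then coeffEval a (x ⟨e, h⟩) else 0) *
        PowerSeries.coeff j (seriesMonomial (fun i => PowerSeries.X ^ k i * a i) e) =
        coeffEval a (∑ e : T, x e *
          PowerSeries.coeff j (seriesMonomial (universalSeries k) e.1)) := by
      intro j
      rw [← Finset.sum_coe_sort, map_sum]
      refine Finset.sum_congr rfl fun e _ => ?_
      rw [map_mul, coeffEval_coeff_seriesMonomial, dif_pos e.2]
    refine ⟨_, fun j hj => (key j).trans ?_, fun h => ha ?_⟩
    · rw [hx0 j hj, map_zero]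
    · rw [← hx1, ← key, h]
  · refine ⟨D, hD, False, fun a ha => ?_⟩
    rw [hmem a, iff_false]
    rintro ⟨x, hx0, hx1⟩
    refine hx1 ((mul_eq_zero.1 ?_).resolve_left ha)
    have h1 : ∀ e ∈ T, coeffEval a D *
        PowerSeries.coeff v (seriesMonomial (fun i => PowerSeries.X ^ k i * a i) e) =
        ∑ j ∈ Finset.range v, coeffEval a (μ j) *
          PowerSeries.coeff j (seriesMonomial (fun i => PowerSeries.X ^ k i * a i) e) := by
      intro e he
      simp_rw [← coeffEval_coeff_seriesMonomial, ← map_mul]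
      rw [hμ ⟨e, he⟩, map_sum]
    calc _ = ∑ e ∈ T, x e * (coeffEval a D * PowerSeries.coeff v
          (seriesMonomial (fun i => PowerSeries.X ^ k i * a i) e)) := by
          rw [Finset.mul_sum]
          exact Finset.sum_congr rfl fun e _ => by ring
      _ = ∑ j ∈ Finset.range v, coeffEval a (μ j) * ∑ e ∈ T, x e * PowerSeries.coeff j
          (seriesMonomial (fun i => PowerSeries.X ^ k i * a i) e) := by
          simp_rw [Finset.mul_sum]
          rw [Finset.sum_comm]
          refine Finset.sum_congr rfl fun e he => ?_
          rw [h1 e he, Finset.mul_sum]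
          exact Finset.sum_congr rfl fun j _ => by ring
      _ = 0 := Finset.sum_eq_zero fun j hj => by
          rw [hx0 j (Finset.mem_range.1 hj), mul_zero]

theorem exists_isGenericValueSemigroup {n : ℕ} {k : Fin n → ℕ} (hk : ∀ i, k i ≠ 0) {N : ℕ}
    {Φ : MvPolynomial (Fin n × ℕ) ℂ} (hΦ : Φ ≠ 0)
    (h : ∀ a : Fin n → PowerSeries ℂ, (∀ i, PowerSeries.constantCoeff (a i) ≠ 0) →
      coeffEval a Φ ≠ 0 → ∀ v, N ≤ v →
        v ∈ valueSemigroup (fun i => PowerSeries.X ^ k i * a i)) :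
    ∃ S : Set ℕ, IsGenericValueSemigroup k S := by
  choose D hD P hP using exists_generic_mem_iff hk
  refine ⟨{v | v < N → P v}, Φ * ∏ v ∈ Finset.range N, D v,
    mul_ne_zero hΦ (Finset.prod_ne_zero_iff.2 fun v _ => hD v), fun a ha hne => ?_⟩
  change coeffEval a _ ≠ 0 at hne
  rw [map_mul, map_prod] at hne
  ext v
  change _ ↔ (v < N → P v)
  by_cases hv : v < N
  · have hDv := Finset.prod_ne_zero_iff.1 (right_ne_zero_of_mul hne) v (Finset.mem_range.2 hv)
    rw [hP v a hDv]
    simp [hv]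
  · simp only [hv, false_imp_iff, iff_true]
    exact h a ha (left_ne_zero_of_mul hne) v (not_lt.1 hv)

theorem exists_coeffEval_ne_zero {n : ℕ} {Φ : MvPolynomial (Fin n × ℕ) ℂ} (hΦ : Φ ≠ 0) :
    ∃ a : Fin n → PowerSeries ℂ, (∀ i, PowerSeries.constantCoeff (a i) ≠ 0) ∧
      coeffEval a Φ ≠ 0 := by
  have h0 : Φ * ∏ i : Fin n, MvPolynomial.X (i, 0) ≠ 0 :=
    mul_ne_zero hΦ (Finset.prod_ne_zero_iff.2 fun i _ => MvPolynomial.X_ne_zero _)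
  obtain ⟨x, hx⟩ : ∃ x : Fin n × ℕ → ℂ,
      MvPolynomial.eval x (Φ * ∏ i : Fin n, MvPolynomial.X (i, 0)) ≠ 0 := by
    by_contra! h
    exact h0 (MvPolynomial.funext fun x => by rw [h x, map_zero])
  rw [map_mul, map_prod] at hx
  refine ⟨fun i => PowerSeries.mk fun j => x (i, j), fun i => ?_, ?_⟩
  · have := Finset.prod_ne_zero_iff.1 (right_ne_zero_of_mul hx) i (Finset.mem_univ i)
    rw [← PowerSeries.coeff_zero_eq_constantCoeff_apply, PowerSeries.coeff_mk]
    simpa using this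
  · simpa [coeffEval] using left_ne_zero_of_mul hx

theorem IsGenericValueSemigroup.unique {n : ℕ} {k : Fin n → ℕ} {S S' : Set ℕ}
    (h : IsGenericValueSemigroup k S) (h' : IsGenericValueSemigroup k S') : S = S' := by
  obtain ⟨Φ, hΦ, h⟩ := h
  obtain ⟨Φ', hΦ', h'⟩ := h'
  obtain ⟨a, ha, hne⟩ := exists_coeffEval_ne_zero (mul_ne_zero hΦ hΦ')
  rw [map_mul] at hne
  rw [← h a ha (left_ne_zero_of_mul hne), ← h' a ha (right_ne_zero_of_mul hne)]

/-- The orders of the three affine coordinates at the cusp. -/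
def cuspOrders (m : ℕ) : Fin 3 → ℕ := ![2 * m, 2 * m + 2, 2 * m + 4]

theorem two_mul_le_cuspOrders (m : ℕ) (i : Fin 3) : 2 * m ≤ cuspOrders m i := by
  fin_cases i <;> simp [cuspOrders]

theorem cuspOrders_ne_zero {m : ℕ} (hm : m ≠ 0) (i : Fin 3) : cuspOrders m i ≠ 0 := by
  have := two_mul_le_cuspOrders m i
  omega

/-- The coefficient of `t ^ (4 m + 5)` in `a₀₀ a₂₀ f₁ ^ 2 - a₁₀ ^ 2 f₀ f₂`. -/
def oddCoeff : MvPolynomial (Fin 3 × ℕ) ℂ :=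
  MvPolynomial.X (0, 0) * MvPolynomial.X (2, 0) *
      (2 * MvPolynomial.X (1, 0) * MvPolynomial.X (1, 1)) -
    MvPolynomial.X (1, 0) ^ 2 * (MvPolynomial.X (0, 0) * MvPolynomial.X (2, 1) +
      MvPolynomial.X (0, 1) * MvPolynomial.X (2, 0))

theorem oddCoeff_ne_zero : oddCoeff ≠ 0 := by
  intro h
  have := congrArg (MvPolynomial.eval
    (fun x : Fin 3 × ℕ => if x.2 = 0 then 1 else if x = (1, 1) then 1 else 0)) h
  simp [oddCoeff] at this

theorem odd_mem_valueSemigroup {m : ℕ} (hm : m ≠ 0) {a : Fin 3 → PowerSeries ℂ}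
    (h : coeffEval a oddCoeff ≠ 0) :
    4 * m + 5 ∈ valueSemigroup (fun i => PowerSeries.X ^ cuspOrders m i * a i) := by
  have hf : ∀ i, PowerSeries.constantCoeff (PowerSeries.X ^ cuspOrders m i * a i) = 0 := fun i =>
    constantCoeff_X_pow_mul (cuspOrders_ne_zero hm i) (a i)
  have hs := hasSubst_of_constantCoeff hf
  let r : ℂ := PowerSeries.coeff 0 (a 0) * PowerSeries.coeff 0 (a 2)
  let s : ℂ := PowerSeries.coeff 0 (a 1) ^ 2
  let u : PowerSeries ℂ := r • a 1 ^ 2 - s • (a 0 * a 2)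
  have hu0 : PowerSeries.coeff 0 u = 0 := by
    simp only [u, r, s, map_sub, PowerSeries.coeff_smul, pow_two]
    simp
    ring
  have hu1 : PowerSeries.coeff 1 u ≠ 0 := by
    convert h using 1
    simp [u, r, s, pow_two, PowerSeries.coeff_mul, Finset.Nat.antidiagonal_succ, oddCoeff,
      coeffEval, -mul_eq_mul_left_iff, -mul_eq_mul_right_iff]
    ring
  refine ⟨r • MvPowerSeries.X 1 ^ 2 - s • (MvPowerSeries.X 0 * MvPowerSeries.X 2), ?_⟩
  rw [MvPowerSeries.subst_sub hs, MvPowerSeries.subst_smul hs, MvPowerSeries.subst_smul hs,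
    MvPowerSeries.subst_mul hs, MvPowerSeries.subst_pow hs, MvPowerSeries.subst_X hs,
    MvPowerSeries.subst_X hs, MvPowerSeries.subst_X hs]
  have hu : r • (PowerSeries.X ^ cuspOrders m 1 * a 1) ^ 2 -
      s • ((PowerSeries.X ^ cuspOrders m 0 * a 0) * (PowerSeries.X ^ cuspOrders m 2 * a 2)) =
      PowerSeries.X ^ (4 * m + 4) * u := by
    simp only [cuspOrders, u, Matrix.cons_val, PowerSeries.smul_eq_C_mul]
    ring
  refine (congrArg PowerSeries.order hu).trans ?_
  rw [PowerSeries.order_mul, PowerSeries.order_X_pow, (PowerSeries.order_eq_nat (n := 1)).2]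
  · push_cast
    ring
  · exact ⟨hu1, fun j hj => by
      obtain rfl : j = 0 := by omega
      exact hu0⟩

theorem mem_valueSemigroup_of_le {m : ℕ} (hm : m ≠ 0) {a : Fin 3 → PowerSeries ℂ}
    (ha : ∀ i, PowerSeries.constantCoeff (a i) ≠ 0) (h : coeffEval a oddCoeff ≠ 0)
    {v : ℕ} (hv : 2 * m ^ 2 + 4 * m + 5 ≤ v) :
    v ∈ valueSemigroup (fun i => PowerSeries.X ^ cuspOrders m i * a i) := by
  have hf : ∀ i, PowerSeries.constantCoeff (PowerSeries.X ^ cuspOrders m i * a i) = 0 := fun i =>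
    constantCoeff_X_pow_mul (cuspOrders_ne_zero hm i) (a i)
  have hmem : ∀ i, cuspOrders m i ∈
      valueSemigroup (fun i => PowerSeries.X ^ cuspOrders m i * a i) := by
    intro i
    refine mem_valueSemigroup_of_order hf i (PowerSeries.order_eq_nat.2 ⟨?_, fun j hj => ?_⟩)
    · rw [PowerSeries.coeff_X_pow_mul', if_pos le_rfl, Nat.sub_self]
      simpa using ha i
    · rw [PowerSeries.coeff_X_pow_mul', if_neg (not_le.2 hj)]
  have heven : ∀ w, m ^ 2 ≤ w →
      2 * w ∈ valueSemigroup (fun i => PowerSeries.X ^ cuspOrders m i * a i) := by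
    intro w hw
    have hle : w % m ≤ w / m := by
      refine (Nat.mod_lt w (Nat.pos_of_ne_zero hm)).le.trans ?_
      rw [Nat.le_div_iff_mul_le (Nat.pos_of_ne_zero hm)]
      nlinarith
    have h2 := add_mem_valueSemigroup hf (mul_mem_valueSemigroup hf (hmem 0) (w / m - w % m))
      (mul_mem_valueSemigroup hf (hmem 1) (w % m))
    convert h2 using 1
    obtain ⟨c, hc⟩ := Nat.exists_eq_add_of_le hle
    have hdm := Nat.div_add_mod w m
    rw [hc] at hdm ⊢
    rw [Nat.add_sub_cancel_left]
    simp only [cuspOrders, Matrix.cons_val]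
    nlinarith
  rcases Nat.even_or_odd' v with ⟨w, rfl | rfl⟩
  · exact heven w (by nlinarith)
  · have h2 := add_mem_valueSemigroup hf (heven (w - (2 * m + 2)) (by omega))
      (odd_mem_valueSemigroup hm h)
    convert h2 using 1
    omega

theorem exists_isGenericValueSemigroup_cuspOrders {m : ℕ} (hm : m ≠ 0) :
    ∃ S, IsGenericValueSemigroup (cuspOrders m) S :=
  exists_isGenericValueSemigroup (cuspOrders_ne_zero hm) oddCoeff_ne_zero
    fun _ ha h _ hv => mem_valueSemigroup_of_le hm ha h hv

theorem finite_compl_of_isGeneric {m : ℕ} (hm : m ≠ 0) {S : Set ℕ}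
    (hS : IsGenericValueSemigroup (cuspOrders m) S) : Sᶜ.Finite := by
  obtain ⟨Φ, hΦ, hS⟩ := hS
  obtain ⟨a, ha, hne⟩ := exists_coeffEval_ne_zero (mul_ne_zero hΦ oddCoeff_ne_zero)
  rw [map_mul] at hne
  rw [← hS a ha (left_ne_zero_of_mul hne)]
  refine (Set.finite_lt_nat (2 * m ^ 2 + 4 * m + 5)).subset fun v hv => ?_
  by_contra h
  exact hv (mem_valueSemigroup_of_le hm ha (right_ne_zero_of_mul hne) (not_lt.1 h))

theorem le_ncard_compl_of_isGeneric {m : ℕ} (hm : m ≠ 0) {S : Set ℕ}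
    (hS : IsGenericValueSemigroup (cuspOrders m) S) : 10 * m ≤ Sᶜ.ncard + 35 := by
  classical
  have hfin := finite_compl_of_isGeneric hm hS
  obtain ⟨Φ, hΦ, hS⟩ := hS
  obtain ⟨a, ha, hne⟩ := exists_coeffEval_ne_zero hΦ
  have hSa := hS a ha hne
  have hf : ∀ i, PowerSeries.constantCoeff (PowerSeries.X ^ cuspOrders m i * a i) = 0 := fun i =>
    constantCoeff_X_pow_mul (cuspOrders_ne_zero hm i) (a i)
  let T' : Finset (Fin 3 → Fin 5) := Finset.univ.filter fun e => ∑ i, (e i : ℕ) ≤ 4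
  let T : Finset (Fin 3 →₀ ℕ) :=
    T'.image fun e => Finsupp.equivFunOnFinite.symm fun i => (e i : ℕ)
  have hcard : T.card ≤ 35 := Finset.card_image_le.trans (by decide)
  have hT : ∀ e, e ∉ T → ∀ j < 10 * m, PowerSeries.coeff j
      (seriesMonomial (fun i => PowerSeries.X ^ cuspOrders m i * a i) e) = 0 := by
    intro e he j hj
    refine coeff_seriesMonomial_eq_zero (k := cuspOrders m) (fun i => Dvd.intro _ rfl) e ?_
    have h5 : 5 ≤ ∑ i, e i := by
      by_contra! h
      have hi : ∀ i, e i < 5 := fun i =>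
        (Finset.single_le_sum (f := fun i => e i) (fun _ _ => Nat.zero_le _)
          (Finset.mem_univ i)).trans_lt h
      refine he (Finset.mem_image.2 ⟨fun i => ⟨e i, hi i⟩, ?_, ?_⟩)
      · simpa [T'] using Nat.lt_succ_iff.1 h
      · ext i
        simp
    calc j < 2 * m * 5 := by omega
      _ ≤ 2 * m * ∑ i, e i := Nat.mul_le_mul_left _ h5
      _ = ∑ i, 2 * m * e i := Finset.mul_sum _ _ _
      _ ≤ _ := Finset.sum_le_sum fun i _ =>
        Nat.mul_le_mul_right _ (two_mul_le_cuspOrders m i)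
  have h1 : ((Finset.range (10 * m)).filter (· ∈ S)).card ≤ T.card := by
    refine card_le_of_subset_valueSemigroup hf hT _ fun v hv => ?_
    rw [Finset.mem_filter, Finset.mem_range] at hv
    exact ⟨hv.1, hSa ▸ hv.2⟩
  have h2 : ((Finset.range (10 * m)).filter (¬ · ∈ S)).card ≤ Sᶜ.ncard := by
    rw [← Set.ncard_coe_finset]
    refine Set.ncard_le_ncard (fun v hv => ?_) hfin
    simp only [Finset.coe_filter, Set.mem_ofPred_eq] at hv
    exact hv.2
  have h3 := Finset.card_filter_add_card_filter_not (s := Finset.range (10 * m)) (· ∈ S)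
  rw [Finset.card_range] at h3
  omega

/-- The expansion at `p` of the monomial `s ^ j u ^ (d - j)`. -/
def monomialExpansion (d : ℕ) (p : OnePoint ℂ) (j : Fin (d + 1)) : PowerSeries ℂ :=
  p.elim (PowerSeries.X ^ (d - (j : ℕ)))
    (fun z => (PowerSeries.C z + PowerSeries.X) ^ (j : ℕ))

theorem expansion_eq_sum {n d : ℕ} (c : Forms n d) (p : OnePoint ℂ) (i : Fin (n + 1)) :
    expansion c p i = ∑ j, PowerSeries.C (c (i, j)) * monomialExpansion d p j := by
  cases p <;> rfl

/-- The action of matrices on tuples of forms. -/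
def act {n d : ℕ} (A : Matrix (Fin (n + 1)) (Fin (n + 1)) ℂ) (c : Forms n d) : Forms n d :=
  fun x => ∑ k, A x.1 k * c (k, x.2)

theorem act_one {n d : ℕ} (c : Forms n d) : act 1 c = c := by
  funext x
  simp [act, Matrix.one_apply]

theorem act_act {n d : ℕ} (A B : Matrix (Fin (n + 1)) (Fin (n + 1)) ℂ) (c : Forms n d) :
    act A (act B c) = act (A * B) c := by
  funext x
  simp only [act, Matrix.mul_apply, Finset.mul_sum, Finset.sum_mul]
  rw [Finset.sum_comm]
  exact Finset.sum_congr rfl fun _ _ => Finset.sum_congr rfl fun _ _ => by ring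

theorem expansion_act {n d : ℕ} (A : Matrix (Fin (n + 1)) (Fin (n + 1)) ℂ) (c : Forms n d)
    (p : OnePoint ℂ) (i : Fin (n + 1)) :
    expansion (act A c) p i = ∑ k, PowerSeries.C (A i k) * expansion c p k := by
  simp only [expansion_eq_sum, act, map_sum, map_mul, Finset.mul_sum, Finset.sum_mul]
  rw [Finset.sum_comm]
  exact Finset.sum_congr rfl fun _ _ => Finset.sum_congr rfl fun _ _ => by ring

theorem value_act {n d : ℕ} (A : Matrix (Fin (n + 1)) (Fin (n + 1)) ℂ) (c : Forms n d)
    (p : OnePoint ℂ) : value (act A c) p = A.mulVec (value c p) := by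
  funext i
  simp [value, expansion_act, Matrix.mulVec, dotProduct]

theorem constantCoeff_germ {n d : ℕ} (c : Forms n d) (p : OnePoint ℂ) (j : Fin (n + 1))
    (i : Fin n) : PowerSeries.constantCoeff (germ c p j i) = 0 := by
  simp [germ, value]

/-- Projective transformations and changes of the chart do not enlarge the value semigroup. -/
theorem valueSemigroup_germ_act_subset {n d : ℕ} (A : Matrix (Fin (n + 1)) (Fin (n + 1)) ℂ)
    (c : Forms n d) (p : OnePoint ℂ) {j j' : Fin (n + 1)} (hj : value c p j ≠ 0)
    (hj' : value (act A c) p j' ≠ 0) :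
    valueSemigroup (germ (act A c) p j') ⊆ valueSemigroup (germ c p j) := by
  have hs := hasSubst_of_constantCoeff (constantCoeff_germ c p j)
  let φ := MvPowerSeries.substAlgHom (R := ℂ) hs
  have hφ : ∀ G, φ G = MvPowerSeries.subst (germ c p j) G := fun G => by
    rw [MvPowerSeries.coe_substAlgHom]
  have hφX : ∀ i, φ (MvPowerSeries.X i) = germ c p j i := fun i => by
    rw [hφ, MvPowerSeries.subst_X hs]
  have hφC : ∀ r : ℂ, φ (MvPowerSeries.C r) = PowerSeries.C r := fun r =>
    φ.commutes r
  let x : Fin (n + 1) → MvPowerSeries (Fin n) ℂ := j.insertNth (α := fun _ => _) 1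
    fun i => MvPowerSeries.X i + MvPowerSeries.C (value c p (j.succAbove i) * (value c p j)⁻¹)
  have hE : PowerSeries.constantCoeff (expansion c p j) ≠ 0 := hj
  have hEE : expansion c p j * (expansion c p j)⁻¹ = 1 := PowerSeries.mul_inv_cancel _ hE
  have hx : ∀ k, φ (x k) = expansion c p k * (expansion c p j)⁻¹ := by
    intro k
    rcases Fin.eq_self_or_eq_succAbove j k with rfl | ⟨i, rfl⟩
    · simp only [x, Fin.insertNth_apply_same, map_one, hEE]
    · simp only [x, Fin.insertNth_apply_succAbove, map_add, hφX, hφC]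
      rw [germ, sub_add_cancel]
  let y : Fin (n + 1) → MvPowerSeries (Fin n) ℂ := fun i => ∑ k, MvPowerSeries.C (A i k) * x k
  have hy : ∀ i, φ (y i) = expansion (act A c) p i * (expansion c p j)⁻¹ := by
    intro i
    simp only [y, map_sum, map_mul, hφC, hx, expansion_act, Finset.sum_mul, mul_assoc]
  have hconst : ∀ G, PowerSeries.constantCoeff (φ G) = MvPowerSeries.constantCoeff G := by
    intro G
    have h0 : φ (G - MvPowerSeries.C (MvPowerSeries.constantCoeff G)) =
        MvPowerSeries.subst (germ c p j) (G - MvPowerSeries.C (MvPowerSeries.constantCoeff G)) :=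
      hφ _
    have h1 : MvPowerSeries.constantCoeff (MvPowerSeries.subst (germ c p j)
        (G - MvPowerSeries.C (MvPowerSeries.constantCoeff G))) = 0 :=
      MvPowerSeries.constantCoeff_subst_eq_zero hs (constantCoeff_germ c p j) (by simp)
    have h2 : PowerSeries.constantCoeff
        (φ (G - MvPowerSeries.C (MvPowerSeries.constantCoeff G))) = 0 := by
      rw [h0]; exact h1
    rw [map_sub, map_sub, hφC, sub_eq_zero] at h2
    simpa using h2
  have hE' : PowerSeries.constantCoeff (expansion (act A c) p j') ≠ 0 := hj'
  have hy0 : MvPowerSeries.constantCoeff (y j') ≠ 0 := by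
    rw [← hconst, hy, map_mul]
    refine mul_ne_zero hE' ?_
    rw [PowerSeries.constantCoeff_inv]
    exact inv_ne_zero hE
  have hinv : φ (y j')⁻¹ = (expansion (act A c) p j')⁻¹ * expansion c p j := by
    have h1 : φ (y j') * φ (y j')⁻¹ = 1 := by
      rw [← map_mul, MvPowerSeries.mul_inv_cancel _ hy0, map_one]
    have h2 : φ (y j') * ((expansion (act A c) p j')⁻¹ * expansion c p j) = 1 := by
      rw [hy]
      calc _ = (expansion (act A c) p j' * (expansion (act A c) p j')⁻¹) *
            (expansion c p j * (expansion c p j)⁻¹) := by ring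
        _ = 1 := by rw [hEE, PowerSeries.mul_inv_cancel _ hE', one_mul]
    have hne : φ (y j') ≠ 0 := left_ne_zero_of_mul (h1.trans_ne one_ne_zero)
    exact mul_left_cancel₀ hne (h1.trans h2.symm)
  let G : Fin n → MvPowerSeries (Fin n) ℂ := fun i => y (j'.succAbove i) * (y j')⁻¹ -
    MvPowerSeries.C (value (act A c) p (j'.succAbove i) * (value (act A c) p j')⁻¹)
  have hG : ∀ i, germ (act A c) p j' i = φ (G i) := by
    intro i
    simp only [G, map_sub, germ]
    rw [map_mul φ, hy, hinv, hφC]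
    congr 1
    calc _ = expansion (act A c) p (j'.succAbove i) * (expansion (act A c) p j')⁻¹ *
          (expansion c p j * (expansion c p j)⁻¹) := by rw [hEE, mul_one]
      _ = _ := by ring
  refine valueSemigroup_subset_of_subst (constantCoeff_germ c p j) G (fun i => ?_)
    (fun i => (hG i).trans (hφ _))
  rw [← hconst, ← hG, constantCoeff_germ]

theorem valueSemigroupAt_eq {n d : ℕ} (c : Forms n d) (p : OnePoint ℂ) {j : Fin (n + 1)}
    (hj : value c p j ≠ 0) : valueSemigroupAt c p = valueSemigroup (germ c p j) := by
  ext v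
  refine ⟨fun ⟨j', hj', hv⟩ => ?_, fun hv => ⟨j, hj, hv⟩⟩
  have h := valueSemigroup_germ_act_subset 1 c p (j' := j') hj (by rwa [act_one])
  rw [act_one] at h
  exact h hv

theorem valueSemigroupAt_act_subset {n d : ℕ} (A : Matrix (Fin (n + 1)) (Fin (n + 1)) ℂ)
    (c : Forms n d) (p : OnePoint ℂ) (hc : value c p ≠ 0) :
    valueSemigroupAt (act A c) p ⊆ valueSemigroupAt c p := by
  obtain ⟨j, hj⟩ := Function.ne_iff.1 hc
  rintro v ⟨j', hj', hv⟩
  exact ⟨j, hj, valueSemigroup_germ_act_subset A c p hj hj' hv⟩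

theorem act_mem_maps {n d : ℕ} {A B : Matrix (Fin (n + 1)) (Fin (n + 1)) ℂ} (hBA : B * A = 1)
    {c : Forms n d} (hc : c ∈ maps n d) : act A c ∈ maps n d := by
  refine ⟨fun p h => hc.1 p ?_, ?_⟩
  · have h1 : B.mulVec (value (act A c) p) = value c p := by
      rw [value_act, Matrix.mulVec_mulVec, hBA, Matrix.one_mulVec]
    rw [← h1, h, Matrix.mulVec_zero]
  · have h := hc.2
    rw [Fintype.linearIndependent_iff] at h ⊢
    intro g hg
    have h1 : Matrix.vecMul g A = 0 := by
      funext k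
      refine h (Matrix.vecMul g A) ?_ k
      funext j
      have := congrFun hg j
      simp only [Finset.sum_apply, Pi.smul_apply, smul_eq_mul, Pi.zero_apply, act,
        Finset.mul_sum] at this
      simp only [Finset.sum_apply, Pi.smul_apply, smul_eq_mul, Pi.zero_apply, Matrix.vecMul,
        dotProduct, Finset.sum_mul]
      rw [Finset.sum_comm, ← this]
      exact Finset.sum_congr rfl fun _ _ => Finset.sum_congr rfl fun _ _ => by ring
    have hAB : A * B = 1 := mul_eq_one_comm.1 hBA
    have h2 : Matrix.vecMul (Matrix.vecMul g A) B = g := by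
      rw [Matrix.vecMul_vecMul, hAB, Matrix.vecMul_one]
    rw [h1, Matrix.zero_vecMul] at h2
    exact fun i => congrFun h2.symm i

theorem valueSemigroupAt_act {n d : ℕ} {A B : Matrix (Fin (n + 1)) (Fin (n + 1)) ℂ}
    (hBA : B * A = 1) {c : Forms n d} (hc : c ∈ maps n d) :
    valueSemigroupAt (act A c) = valueSemigroupAt c := by
  funext p
  refine (valueSemigroupAt_act_subset A c p (hc.1 p)).antisymm ?_
  have h := valueSemigroupAt_act_subset B (act A c) p ((act_mem_maps hBA hc).1 p)
  rwa [act_act, hBA, act_one] at h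

theorem act_mem_severi {n d g : ℕ} {S : Set ℕ} {A B : Matrix (Fin (n + 1)) (Fin (n + 1)) ℂ}
    (hBA : B * A = 1) {c : Forms n d} (hc : c ∈ severi n d g S) : act A c ∈ severi n d g S := by
  obtain ⟨hM, hinj, hg, p, hp, hS, hq⟩ := hc
  have hv := valueSemigroupAt_act hBA hM
  refine ⟨act_mem_maps hBA hM, fun q q' h => hinj ?_, ?_, p, ?_⟩
  · rw [toMap, toMap, Projectivization.mk_eq_mk_iff'] at h ⊢
    obtain ⟨a, ha⟩ := h
    refine ⟨a, ?_⟩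
    have h1 := congrArg B.mulVec ha
    rwa [Matrix.mulVec_smul, value_act, value_act, Matrix.mulVec_mulVec, Matrix.mulVec_mulVec,
      hBA, Matrix.one_mulVec, Matrix.one_mulVec] at h1
  · rw [arithGenus, hv]
    exact hg
  · rw [hv]
    exact ⟨hp, hS, hq⟩

/-- The image of a polynomial map from an affine space of smaller dimension lies in a
hypersurface. -/
theorem exists_eval_eq_zero_of_card_lt {σ τ : Type} [Fintype σ] [Fintype τ]
    (h : Fintype.card τ < Fintype.card σ) (p : σ → MvPolynomial τ ℂ) :
    ∃ Ψ : MvPolynomial σ ℂ, Ψ ≠ 0 ∧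
      ∀ y : τ → ℂ, MvPolynomial.eval (fun s => MvPolynomial.eval y (p s)) Ψ = 0 := by
  have hp : ¬ AlgebraicIndependent ℂ p := by
    intro hp
    have h1 := hp.cardinalMk_le_trdeg
    rw [MvPolynomial.trdeg_of_isDomain, Cardinal.mk_fintype, Cardinal.mk_fintype,
      Cardinal.lift_natCast, Nat.cast_le] at h1
    omega
  rw [algebraicIndependent_iff] at hp
  push Not at hp
  obtain ⟨Ψ, h0, hne⟩ := hp
  refine ⟨Ψ, hne, fun y => ?_⟩
  have h1 := congrArg (MvPolynomial.eval y) h0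
  rw [map_zero, MvPolynomial.aeval_def] at h1
  simp only [MvPolynomial.eval₂_eq', map_sum, map_mul, map_prod, map_pow,
    MvPolynomial.algebraMap_eq, MvPolynomial.eval_C] at h1
  rw [MvPolynomial.eval_eq']
  exact h1

/-- The forms whose `i`-th row has no coefficients before the column `k i`. -/
def mask {n d : ℕ} {R : Type*} [Zero R] (k : Fin (n + 1) → ℕ)
    (x : Fin (n + 1) × Fin (d + 1) → R) : Fin (n + 1) × Fin (d + 1) → R :=
  fun s => if k s.1 ≤ s.2 then x s else 0

/-- If more rows `i ∈ I` of `mask k x` satisfy the linear equation with coefficients `w j` than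
the number `r` of parameters that `w` depends on, then `x` lies on a hypersurface. -/
theorem exists_eval_eq_zero_of_incidence {n d r : ℕ} (k : Fin (n + 1) → ℕ)
    (I : Finset (Fin (n + 1))) (hr : r < I.card) (w : Fin (d + 1) → MvPolynomial (Fin r) ℂ)
    (j₀ : Fin (d + 1)) (hj₀ : ∀ i ∈ I, k i ≤ j₀) :
    ∃ Ψ : MvPolynomial (Fin (n + 1) × Fin (d + 1)) ℂ, Ψ ≠ 0 ∧ ∀ x : Forms n d, ∀ y : Fin r → ℂ,
      MvPolynomial.eval y (w j₀) ≠ 0 →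
      (∀ i ∈ I, ∑ j, mask k x (i, j) * MvPolynomial.eval y (w j) = 0) →
      MvPolynomial.eval x Ψ = 0 := by
  classical
  let τ := Fin r ⊕ {s : Fin (n + 1) × Fin (d + 1) // ¬ (s.1 ∈ I ∧ s.2 = j₀)}
  have hcard : Fintype.card τ < Fintype.card (Fin (n + 1) × Fin (d + 1)) := by
    have h1 : Fintype.card {s : Fin (n + 1) × Fin (d + 1) // s.1 ∈ I ∧ s.2 = j₀} = I.card := by
      rw [Fintype.card_subtype]
      have : (Finset.univ.filter fun s : Fin (n + 1) × Fin (d + 1) => s.1 ∈ I ∧ s.2 = j₀) =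
          I ×ˢ {j₀} := by
        ext s
        rw [Finset.mem_product]
        simp
      rw [this, Finset.card_product, Finset.card_singleton, mul_one]
    have h2 := Fintype.card_subtype_compl
      (fun s : Fin (n + 1) × Fin (d + 1) => s.1 ∈ I ∧ s.2 = j₀)
    have h3 := Fintype.card_subtype_le (fun s : Fin (n + 1) × Fin (d + 1) => s.1 ∈ I ∧ s.2 = j₀)
    simp only [τ, Fintype.card_sum, Fintype.card_fin]
    omega
  let V : Fin (n + 1) × Fin (d + 1) → MvPolynomial τ ℂ := fun s =>
    if h : ¬ (s.1 ∈ I ∧ s.2 = j₀) then MvPolynomial.X (Sum.inr ⟨s, h⟩) else 0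
  let W : Fin (d + 1) → MvPolynomial τ ℂ := fun j => MvPolynomial.rename Sum.inl (w j)
  obtain ⟨Ψ, hΨ, h⟩ := exists_eval_eq_zero_of_card_lt hcard fun s =>
    if s.1 ∈ I ∧ s.2 = j₀ then -∑ j, mask k V (s.1, j) * W j else V s * W j₀
  refine ⟨Ψ, hΨ, fun x y hρ hy => ?_⟩
  set ρ := MvPolynomial.eval y (w j₀) with hρdef
  let Y : τ → ℂ := Sum.elim y fun s => x s.1 / ρ
  have hW : ∀ j, MvPolynomial.eval Y (W j) = MvPolynomial.eval y (w j) := fun j => by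
    simp only [W, MvPolynomial.eval_rename]
    rfl
  have hV : ∀ s, MvPolynomial.eval Y (V s) = if s.1 ∈ I ∧ s.2 = j₀ then 0 else x s / ρ := by
    intro s
    by_cases hs : s.1 ∈ I ∧ s.2 = j₀
    · simp only [V, dif_neg (not_not.2 hs), if_pos hs, map_zero]
    · simp only [V, dif_pos hs, if_neg hs, MvPolynomial.eval_X, Y, Sum.elim_inr]
  rw [← h Y]
  congr 2
  funext ⟨i, j⟩
  by_cases hs : i ∈ I ∧ j = j₀
  · obtain ⟨hi, rfl⟩ := hs
    simp only [hi, and_self, if_true, map_neg, map_sum, map_mul, hW]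
    have h1 := hy i hi
    rw [← Finset.add_sum_erase _ _ (Finset.mem_univ j)] at h1 ⊢
    have h2 : MvPolynomial.eval Y (mask k V (i, j)) = 0 := by
      simp only [mask, hj₀ i hi, if_true, hV, hi, and_self]
    have h3 : ∀ l ∈ Finset.univ.erase j, MvPolynomial.eval Y (mask k V (i, l)) *
        MvPolynomial.eval y (w l) = ρ⁻¹ * (mask k x (i, l) * MvPolynomial.eval y (w l)) := by
      intro l hl
      have hne := Finset.ne_of_mem_erase hl
      simp only [mask]
      split_ifs
      · rw [hV, if_neg fun h => hne h.2]
        ring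
      · simp
    rw [h2, zero_mul, zero_add, Finset.sum_congr rfl h3, ← Finset.mul_sum,
      eq_neg_of_add_eq_zero_right h1]
    simp only [mask, hj₀ i hi, if_true]
    rw [← hρdef]
    field_simp
  · simp only [hs, if_false, map_mul, hW, hV]
    rw [← hρdef]
    field_simp

theorem height_map_quotient_le {R : Type*} [CommRing R] {I J P : Ideal R} [P.IsPrime]
    (hJ : J ≤ P) (hI : I ≤ P) : (I.map (Ideal.Quotient.mk J)).height ≤ P.height := by
  have hsurj : Function.Surjective (Ideal.Quotient.mk J) := Ideal.Quotient.mk_surjective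
  have hker : RingHom.ker (Ideal.Quotient.mk J) ≤ P := by rwa [Ideal.mk_ker]
  have hprime : (P.map (Ideal.Quotient.mk J)).IsPrime := Ideal.map_isPrime_of_surjective hsurj hker
  have hcomap : (P.map (Ideal.Quotient.mk J)).comap (Ideal.Quotient.mk J) = P := by
    rw [Ideal.comap_map_of_surjective' _ hsurj, sup_eq_left.2 hker]
  refine (Ideal.height_mono (Ideal.map_mono hI)).trans ?_
  have hmono : StrictMono (PrimeSpectrum.comap (Ideal.Quotient.mk J)) := by
    refine Monotone.strictMono_of_injective (fun p q h => Ideal.comap_mono h) ?_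
    exact PrimeSpectrum.comap_injective_of_surjective _ hsurj
  have h := Order.height_le_height_apply_of_strictMono _ hmono
    ⟨P.map (Ideal.Quotient.mk J), hprime⟩
  have h2 : PrimeSpectrum.comap (Ideal.Quotient.mk J) ⟨P.map (Ideal.Quotient.mk J), hprime⟩ =
      ⟨P, inferInstance⟩ := PrimeSpectrum.ext hcomap
  rwa [h2, ← PrimeSpectrum.height_eq_orderHeight, ← PrimeSpectrum.height_eq_orderHeight] at h

/-- If `V` is dense in the nonempty open part `Δ ≠ 0` of the locus defined by a finite set `E` of
equations, then the codimension of `V` is at most the number of equations. -/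
theorem codim_le_card {σ : Type*} [Finite σ] {V M : Set (σ → ℂ)} (hVM : V ⊆ M)
    (E : Finset (MvPolynomial σ ℂ)) (Δ : MvPolynomial σ ℂ) {x₀ : σ → ℂ}
    (hE : ∀ e ∈ E, MvPolynomial.eval x₀ e = 0) (hΔ : MvPolynomial.eval x₀ Δ ≠ 0)
    (hdense : ∀ h : MvPolynomial σ ℂ, (∀ x ∈ V, MvPolynomial.eval x h = 0) → ∀ x,
      (∀ e ∈ E, MvPolynomial.eval x e = 0) → MvPolynomial.eval x Δ ≠ 0 →
      MvPolynomial.eval x h = 0) :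
    codim V M ≤ E.card := by
  let I : Ideal (MvPolynomial σ ℂ) := Ideal.span (E : Set (MvPolynomial σ ℂ))
  have hzero : ∀ x : σ → ℂ, x ∈ MvPolynomial.zeroLocus ℂ I ↔
      ∀ e ∈ E, MvPolynomial.eval x e = 0 := by
    intro x
    rw [MvPolynomial.zeroLocus_span]
    simp [MvPolynomial.aeval_eq_eval]
  have hrad : ∀ h : MvPolynomial σ ℂ, h ∈ I.radical ↔
      ∀ x, (∀ e ∈ E, MvPolynomial.eval x e = 0) → MvPolynomial.eval x h = 0 := by
    intro h
    rw [← MvPolynomial.vanishingIdeal_zeroLocus_eq_radical (K := ℂ)]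
    simp only [MvPolynomial.mem_vanishingIdeal_iff, hzero, MvPolynomial.aeval_eq_eval]
  have hΔrad : Δ ∉ sInf I.minimalPrimes := by
    rw [Ideal.sInf_minimalPrimes, hrad]
    exact fun h => hΔ (h x₀ hE)
  rw [Submodule.mem_sInf] at hΔrad
  push Not at hΔrad
  obtain ⟨P', hP, hΔP⟩ := hΔrad
  let P : Ideal (MvPolynomial σ ℂ) := P'
  have : P.IsPrime := hP.1.1
  have hV : MvPolynomial.vanishingIdeal ℂ V ≤ P := by
    intro h hh
    have h1 : h * Δ ∈ I.radical := by
      rw [hrad]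
      intro x hx
      rw [map_mul]
      by_cases hx0 : MvPolynomial.eval x Δ = 0
      · rw [hx0, mul_zero]
      · rw [hdense h (fun y hy => by simpa [MvPolynomial.aeval_eq_eval] using hh y hy) x hx hx0,
          zero_mul]
    have h2 : h * Δ ∈ P := (Ideal.IsPrime.radical_le_iff this).2 hP.1.2 h1
    exact (this.mem_or_mem h2).resolve_right hΔP
  have hM : MvPolynomial.vanishingIdeal ℂ M ≤ P :=
    (MvPolynomial.vanishingIdeal_anti_mono hVM).trans hV
  exact (height_map_quotient_le hM hV).trans
    (Ideal.height_le_card_of_mem_minimalPrimes_span_finset hP)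

section Gauss

variable {d : ℕ} {R : Type*} [CommRing R]

/-- Fraction-free elimination of the column `z` with the row `0`. -/
def gauss₁ (z : Fin (d + 1)) (c : Fin 4 × Fin (d + 1) → R) (i : Fin 4) (j : Fin (d + 1)) : R :=
  c (0, z) * c (i, j) - c (i, z) * c (0, j)

/-- Fraction-free elimination of the columns `z`, `p` with the rows `0`, `1`. -/
def gauss₂ (z p : Fin (d + 1)) (c : Fin 4 × Fin (d + 1) → R) (i : Fin 4) (j : Fin (d + 1)) : R :=
  gauss₁ z c 1 p * gauss₁ z c i j - gauss₁ z c i p * gauss₁ z c 1 j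

/-- Fraction-free elimination of the columns `z`, `p`, `q` with the rows `0`, `1`, `2`. -/
def gauss₃ (z p q : Fin (d + 1)) (c : Fin 4 × Fin (d + 1) → R) (j : Fin (d + 1)) : R :=
  gauss₂ z p c 2 q * gauss₂ z p c 3 j - gauss₂ z p c 3 q * gauss₂ z p c 2 j

/-- The product of the pivots of the elimination. -/
def gaussPivots (z p q : Fin (d + 1)) (c : Fin 4 × Fin (d + 1) → R) : R :=
  c (0, z) * gauss₁ z c 1 p * gauss₂ z p c 2 q

theorem eval_gauss₁ (z : Fin (d + 1)) (c : Forms 3 d) (i : Fin 4) (j : Fin (d + 1)) :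
    MvPolynomial.eval c (gauss₁ z MvPolynomial.X i j) = gauss₁ z c i j := by
  simp [gauss₁]

theorem eval_gauss₂ (z p : Fin (d + 1)) (c : Forms 3 d) (i : Fin 4) (j : Fin (d + 1)) :
    MvPolynomial.eval c (gauss₂ z p MvPolynomial.X i j) = gauss₂ z p c i j := by
  simp [gauss₂, eval_gauss₁]

theorem eval_gauss₃ (z p q : Fin (d + 1)) (c : Forms 3 d) (j : Fin (d + 1)) :
    MvPolynomial.eval c (gauss₃ z p q MvPolynomial.X j) = gauss₃ z p q c j := by
  simp [gauss₃, eval_gauss₂]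

theorem eval_gaussPivots (z p q : Fin (d + 1)) (c : Forms 3 d) :
    MvPolynomial.eval c (gaussPivots z p q MvPolynomial.X) = gaussPivots z p q c := by
  simp [gaussPivots, eval_gauss₂, eval_gauss₁]

/-- The matrix of the elimination. -/
def gaussMatrix (z p q : Fin (d + 1)) (c : Forms 3 d) : Matrix (Fin 4) (Fin 4) ℂ :=
  let u := c (0, z)
  let v := gauss₁ z c 1 p
  let w := gauss₂ z p c 2 q
  !![1, 0, 0, 0;
    -c (1, z), u, 0, 0;
    gauss₁ z c 2 p * c (1, z) - v * c (2, z), -gauss₁ z c 2 p * u, v * u, 0;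
    w * (gauss₁ z c 3 p * c (1, z) - v * c (3, z)) -
      gauss₂ z p c 3 q * (gauss₁ z c 2 p * c (1, z) - v * c (2, z)),
    -w * gauss₁ z c 3 p * u + gauss₂ z p c 3 q * (gauss₁ z c 2 p * u),
    -gauss₂ z p c 3 q * (v * u), w * (v * u)]

theorem det_gaussMatrix_ne_zero {z p q : Fin (d + 1)} {c : Forms 3 d}
    (h : gaussPivots z p q c ≠ 0) : (gaussMatrix z p q c).det ≠ 0 := by
  have hw := right_ne_zero_of_mul h
  have hv := right_ne_zero_of_mul (left_ne_zero_of_mul h)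
  have hu := left_ne_zero_of_mul (left_ne_zero_of_mul h)
  rw [Matrix.det_of_isLowerTriangular]
  · simp only [Fin.prod_univ_four, gaussMatrix, Matrix.of_apply, Matrix.cons_val]
    exact mul_ne_zero (mul_ne_zero (mul_ne_zero one_ne_zero hu) (mul_ne_zero hv hu))
      (mul_ne_zero hw (mul_ne_zero hv hu))
  · intro i j hij
    have hij : i < j := hij
    fin_cases i <;> fin_cases j <;> first | rfl | exact absurd hij (by decide)

theorem act_gaussMatrix (z p q : Fin (d + 1)) (c : Forms 3 d) (j : Fin (d + 1)) :
    act (gaussMatrix z p q c) c (0, j) = c (0, j) ∧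
    act (gaussMatrix z p q c) c (1, j) = gauss₁ z c 1 j ∧
    act (gaussMatrix z p q c) c (2, j) = gauss₂ z p c 2 j ∧
    act (gaussMatrix z p q c) c (3, j) = gauss₃ z p q c j := by
  have hsum : ∀ i : Fin 4, act (gaussMatrix z p q c) c (i, j) =
      gaussMatrix z p q c i 0 * c (0, j) + gaussMatrix z p q c i 1 * c (1, j) +
      gaussMatrix z p q c i 2 * c (2, j) + gaussMatrix z p q c i 3 * c (3, j) := fun i =>
    Fin.sum_univ_four _
  refine ⟨(hsum 0).trans ?_, (hsum 1).trans ?_, (hsum 2).trans ?_, (hsum 3).trans ?_⟩ <;>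
    simp only [gaussMatrix, Matrix.of_apply, Matrix.cons_val]
  · ring
  · simp only [gauss₁]
    ring
  · simp only [gauss₂]
    generalize gauss₁ z c 1 p = v
    generalize gauss₁ z c 2 p = v'
    simp only [gauss₁]
    ring
  · simp only [gauss₃]
    generalize gauss₂ z p c 2 q = w
    generalize gauss₂ z p c 3 q = w'
    simp only [gauss₂]
    generalize gauss₁ z c 1 p = v
    generalize gauss₁ z c 2 p = v'
    generalize gauss₁ z c 3 p = v''
    simp only [gauss₁]
    ring

end Gauss

/-- The vanishing orders of the four forms at the cusp. -/
def formOrders (m : ℕ) : Fin 4 → ℕ := ![0, 2 * m, 2 * m + 2, 2 * m + 4]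

/-- If the orbit of `V` under the projective transformations contains a dense subset of the forms
with vanishing orders `formOrders m`, then it has codimension at most `6 m`. -/
theorem codim_le_of_dense {m d : ℕ} (hm : m ≠ 0) (hd : 2 * m + 4 ≤ d) {V M : Set (Forms 3 d)}
    (hVM : V ⊆ M)
    (hV : ∀ A B : Matrix (Fin 4) (Fin 4) ℂ, B * A = 1 → ∀ c ∈ V, act A c ∈ V)
    (hdense : ∀ h : MvPolynomial (Fin 4 × Fin (d + 1)) ℂ, h ≠ 0 →
      ∃ x : Forms 3 d, MvPolynomial.eval x h ≠ 0 ∧ mask (formOrders m) x ∈ V) :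
    codim V M ≤ (6 * m : ℕ) := by
  classical
  let col : ℕ → Fin (d + 1) := fun j => Fin.ofNat (d + 1) j
  have hcol : ∀ j, j ≤ d → (col j : ℕ) = j := fun j hj =>
    Nat.mod_eq_of_lt (Nat.lt_succ_of_le hj)
  have hcol' : ∀ j : Fin (d + 1), col j = j := fun j => Fin.ext (hcol j (by omega))
  let z := col 0
  let p := col (2 * m)
  let q := col (2 * m + 2)
  let E : Finset (MvPolynomial (Fin 4 × Fin (d + 1)) ℂ) :=
    (Finset.univ.image fun s : Fin 3 × Fin (2 * m - 1) =>
      gauss₁ z MvPolynomial.X s.1.succ (col (s.2 + 1))) ∪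
    {gauss₂ z p MvPolynomial.X 2 (col (2 * m + 1)), gauss₂ z p MvPolynomial.X 3 (col (2 * m + 1)),
      gauss₃ z p q MvPolynomial.X (col (2 * m + 3))}
  have hEcard : E.card ≤ 6 * m := by
    refine (Finset.card_union_le _ _).trans ?_
    have h1 := (Finset.card_image_le (s := (Finset.univ : Finset (Fin 3 × Fin (2 * m - 1))))
      (f := fun s => gauss₁ (R := MvPolynomial (Fin 4 × Fin (d + 1)) ℂ) z MvPolynomial.X s.1.succ
        (col (s.2 + 1))))
    have h2 := Finset.card_le_three (a := gauss₂ (R := MvPolynomial (Fin 4 × Fin (d + 1)) ℂ) z p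
      MvPolynomial.X 2 (col (2 * m + 1))) (b := gauss₂ z p MvPolynomial.X 3 (col (2 * m + 1)))
      (c := gauss₃ z p q MvPolynomial.X (col (2 * m + 3)))
    rw [Finset.card_univ, Fintype.card_prod, Fintype.card_fin, Fintype.card_fin] at h1
    omega
  have hE : ∀ c : Forms 3 d, (∀ e ∈ E, MvPolynomial.eval c e = 0) ↔
      (∀ i : Fin 3, ∀ j, 1 ≤ j → j < 2 * m → gauss₁ z c i.succ (col j) = 0) ∧
      gauss₂ z p c 2 (col (2 * m + 1)) = 0 ∧ gauss₂ z p c 3 (col (2 * m + 1)) = 0 ∧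
      gauss₃ z p q c (col (2 * m + 3)) = 0 := by
    intro c
    simp only [E, Finset.mem_union, Finset.mem_image, Finset.mem_univ, true_and,
      Finset.mem_insert, Finset.mem_singleton, or_imp, forall_and, forall_exists_index,
      forall_apply_eq_imp_iff, forall_eq, eval_gauss₁, eval_gauss₂, eval_gauss₃]
    refine and_congr_left fun _ => ⟨fun h i j hj1 hj2 => ?_, fun h s => ?_⟩
    · have := h (i, ⟨j - 1, by omega⟩)
      rwa [Nat.sub_add_cancel hj1] at this
    · exact h s.1 _ (by omega) (by have := s.2.2; omega)
  let x₀ : Forms 3 d := fun s => if formOrders m s.1 = s.2 then 1 else 0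
  have hx₀ : ∀ i j, j ≤ d → x₀ (i, col j) = if formOrders m i = j then 1 else 0 := by
    intro i j hj
    simp only [x₀, hcol j hj]
  have hz : ∀ i : Fin 4, x₀ (i, z) = if i = 0 then 1 else 0 := by
    intro i
    rw [hx₀ i 0 (by omega)]
    fin_cases i <;> simp [formOrders, hm]
  have hp : ∀ i : Fin 4, x₀ (i, p) = if i = 1 then 1 else 0 := by
    intro i
    rw [hx₀ i _ (by omega)]
    fin_cases i <;> simp [formOrders, hm]
  have hq : ∀ i : Fin 4, x₀ (i, q) = if i = 2 then 1 else 0 := by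
    intro i
    rw [hx₀ i _ (by omega)]
    fin_cases i <;> simp [formOrders]
  have hg1 : ∀ i j, i ≠ 0 → gauss₁ z x₀ i j = x₀ (i, j) := by
    intro i j hi
    simp [gauss₁, hz, hi]
  have hg2 : ∀ i j, i ≠ 0 → i ≠ 1 → gauss₂ z p x₀ i j = x₀ (i, j) := by
    intro i j hi hi'
    simp [gauss₂, hg1, hi, hp, hi']
  have hg3 : ∀ j, gauss₃ z p q x₀ j = x₀ (3, j) := by
    intro j
    simp [gauss₃, hg2, hq]
  refine (codim_le_card hVM E (gaussPivots z p q MvPolynomial.X) (x₀ := x₀) ((hE x₀).2 ?_) ?_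
    ?_).trans (by exact_mod_cast hEcard)
  · refine ⟨fun i j hj1 hj2 => ?_, ?_, ?_, ?_⟩
    · rw [hg1 _ _ (Fin.succ_ne_zero i), hx₀ _ _ (by omega), if_neg]
      fin_cases i <;> simp [formOrders] <;> omega
    · rw [hg2 _ _ (by decide) (by decide), hx₀ _ _ (by omega), if_neg]
      simp [formOrders]
    · rw [hg2 _ _ (by decide) (by decide), hx₀ _ _ (by omega), if_neg]
      simp [formOrders]
    · rw [hg3, hx₀ _ _ (by omega), if_neg]
      simp [formOrders]
  · rw [eval_gaussPivots, gaussPivots, hg1 _ _ (by decide), hg2 _ _ (by decide) (by decide), hz,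
      hp, hq]
    simp
  · intro h hh c hc hΔ
    rw [eval_gaussPivots] at hΔ
    obtain ⟨e1, e2, e2', e3⟩ := (hE c).1 hc
    set B := gaussMatrix z p q c with hBdef
    have hB : B⁻¹ * B = 1 := Matrix.nonsing_inv_mul _ (det_gaussMatrix_ne_zero hΔ).isUnit
    have hB' : B * B⁻¹ = 1 := Matrix.mul_nonsing_inv _ (det_gaussMatrix_ne_zero hΔ).isUnit
    have hg1z : ∀ i : Fin 4, gauss₁ z c i z = 0 := fun i => by simp only [gauss₁]; ring
    have hg2p : ∀ i : Fin 4, gauss₂ z p c i p = 0 := fun i => by simp only [gauss₂]; ring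
    have hg1lt : ∀ i : Fin 3, ∀ j : Fin (d + 1), (j : ℕ) < 2 * m → gauss₁ z c i.succ j = 0 := by
      intro i j hj
      rw [← hcol' j]
      rcases Nat.eq_zero_or_pos (j : ℕ) with h0 | h0
      · rw [h0]; exact hg1z _
      · exact e1 i j h0 hj
    have hg2lt : ∀ i : Fin 3, gauss₂ z p c i.succ (col (2 * m + 1)) = 0 →
        ∀ j : Fin (d + 1), (j : ℕ) < 2 * m + 2 → gauss₂ z p c i.succ j = 0 := by
      intro i hi j hj
      rcases lt_or_ge (j : ℕ) (2 * m) with h0 | h0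
      · simp only [gauss₂]
        rw [hg1lt i j h0, show (1 : Fin 4) = (0 : Fin 3).succ from rfl, hg1lt 0 j h0]
        ring
      · rw [← hcol' j]
        rcases Nat.eq_or_lt_of_le h0 with h1 | h1
        · rw [← h1]; exact hg2p _
        · rw [show (j : ℕ) = 2 * m + 1 by omega]; exact hi
    have hmask : mask (formOrders m) (act B c) = act B c := by
      funext ⟨i, j⟩
      simp only [mask]
      split_ifs with hij
      · rfl
      · rw [not_le] at hij
        obtain ⟨h0, h1, h2, h3⟩ := act_gaussMatrix z p q c j
        fin_cases i
        · simp [formOrders] at hij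
        · refine (h1.trans (hg1lt 0 j ?_)).symm
          simpa [formOrders] using hij
        · refine (h2.trans (hg2lt 1 e2 j ?_)).symm
          simpa [formOrders] using hij
        · have hj : (j : ℕ) < 2 * m + 4 := by simpa [formOrders] using hij
          refine (h3.trans ?_).symm
          rcases lt_or_ge (j : ℕ) (2 * m + 2) with h0 | h0
          · have a1 := hg2lt 1 e2 j h0
            have a2 := hg2lt 2 e2' j h0
            simp only [gauss₃]
            exact (congrArg₂ (· - ·) (congrArg _ a2) (congrArg _ a1)).trans (by ring)
          · rw [← hcol' j]
            rcases Nat.eq_or_lt_of_le h0 with h1 | h1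
            · rw [← h1]
              simp only [gauss₃]
              exact sub_eq_zero.2 (mul_comm _ _)
            · rw [show (j : ℕ) = 2 * m + 3 by omega]
              exact e3
    let H : MvPolynomial (Fin 4 × Fin (d + 1)) ℂ :=
      MvPolynomial.aeval (fun s => ∑ k, MvPolynomial.C (B⁻¹ s.1 k) *
        mask (formOrders m) MvPolynomial.X (k, s.2)) h
    have hH : ∀ x, MvPolynomial.eval x H =
        MvPolynomial.eval (act B⁻¹ (mask (formOrders m) x)) h := by
      intro x
      simp only [H, MvPolynomial.aeval_def, MvPolynomial.eval₂_eq', map_sum, map_mul, map_prod,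
        map_pow, MvPolynomial.algebraMap_eq, MvPolynomial.eval_C, MvPolynomial.eval_eq' _ h]
      refine Finset.sum_congr rfl fun e _ => ?_
      congr 1
      refine Finset.prod_congr rfl fun s _ => ?_
      congr 1
      refine Finset.sum_congr rfl fun k _ => ?_
      congr 1
      simp only [mask]
      split_ifs <;> simp
    have hH0 : H = 0 := by
      by_contra hne
      obtain ⟨x, hx, hxV⟩ := hdense H hne
      rw [hH] at hx
      exact hx (hh _ (hV _ _ hB' _ hxV))
    have h1 := hH (act B c)
    rw [hH0, map_zero, hmask, act_act, hB, act_one] at h1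
    exact h1.symm

/-- The linear coefficients of the expansion at `p`. -/
def slope {n d : ℕ} (c : Forms n d) (p : OnePoint ℂ) : Fin (n + 1) → ℂ :=
  fun i => PowerSeries.coeff 1 (expansion c p i)

theorem coeff_expansion_coe {n d : ℕ} (c : Forms n d) (z : ℂ) (i : Fin (n + 1)) (l : ℕ) :
    PowerSeries.coeff l (expansion c (z : OnePoint ℂ) i) =
      ∑ j : Fin (d + 1), c (i, j) * (z ^ ((j : ℕ) - l) * ((j : ℕ).choose l : ℂ)) := by
  change PowerSeries.coeff l (∑ j : Fin (d + 1),
      PowerSeries.C (c (i, j)) * (PowerSeries.C z + PowerSeries.X) ^ (j : ℕ)) = _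
  rw [map_sum]
  refine Finset.sum_congr rfl fun j _ => ?_
  rw [PowerSeries.coeff_C_mul, ← Polynomial.coeff_X_add_C_pow, ← Polynomial.coeff_coe]
  simp [add_comm]

theorem value_coe {n d : ℕ} (c : Forms n d) (z : ℂ) (i : Fin (n + 1)) :
    value c (z : OnePoint ℂ) i = ∑ j : Fin (d + 1), c (i, j) * z ^ (j : ℕ) := by
  rw [value, ← PowerSeries.coeff_zero_eq_constantCoeff_apply, coeff_expansion_coe]
  simp

theorem slope_coe {n d : ℕ} (c : Forms n d) (z : ℂ) (i : Fin (n + 1)) :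
    slope c (z : OnePoint ℂ) i =
      ∑ j : Fin (d + 1), c (i, j) * (((j : ℕ) : ℂ) * z ^ ((j : ℕ) - 1)) := by
  rw [slope, coeff_expansion_coe]
  simp [mul_comm]

theorem coeff_expansion_zero {n d : ℕ} (c : Forms n d) (i : Fin (n + 1)) (l : ℕ) :
    PowerSeries.coeff l (expansion c ((0 : ℂ) : OnePoint ℂ) i) =
      if h : l < d + 1 then c (i, ⟨l, h⟩) else 0 := by
  change PowerSeries.coeff l (∑ j : Fin (d + 1),
      PowerSeries.C (c (i, j)) * (PowerSeries.C 0 + PowerSeries.X) ^ (j : ℕ)) = _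
  simp only [map_zero, zero_add, map_sum, PowerSeries.coeff_C_mul, PowerSeries.coeff_X_pow]
  split_ifs with h
  · rw [Finset.sum_eq_single ⟨l, h⟩]
    · simp
    · intro j _ hj
      rw [if_neg fun h => hj (Fin.ext h.symm), mul_zero]
    · simp
  · refine Finset.sum_eq_zero fun j _ => ?_
    rw [if_neg (by have := j.2; omega), mul_zero]

theorem coeff_expansion_infty {n d : ℕ} (c : Forms n d) (i : Fin (n + 1)) {l : ℕ} (hl : l ≤ d) :
    PowerSeries.coeff l (expansion c OnePoint.infty i) = c (i, ⟨d - l, by omega⟩) := by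
  change PowerSeries.coeff l (∑ j : Fin (d + 1),
      PowerSeries.C (c (i, j)) * PowerSeries.X ^ (d - (j : ℕ))) = _
  simp only [map_sum, PowerSeries.coeff_C_mul, PowerSeries.coeff_X_pow]
  rw [Finset.sum_eq_single ⟨d - l, by omega⟩]
  · rw [if_pos (by simp only []; omega), mul_one]
  · intro j _ hj
    rw [if_neg fun h => hj (Fin.ext (by simp only []; have := j.2; omega)), mul_zero]
  · simp

theorem valueSemigroupAt_eq_univ {n d : ℕ} {c : Forms n d} {p : OnePoint ℂ}
    (hv : value c p ≠ 0) (hs : ∀ r : ℂ, slope c p ≠ r • value c p) :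
    valueSemigroupAt c p = Set.univ := by
  obtain ⟨j, hj⟩ := Function.ne_iff.1 hv
  have hj : value c p j ≠ 0 := hj
  rw [valueSemigroupAt_eq c p hj]
  by_contra hne
  have h0 : ∀ i, PowerSeries.coeff 1 (germ c p j i) = 0 := fun i => by
    by_contra h
    exact hne (valueSemigroup_eq_univ (constantCoeff_germ c p j) i h)
  have hEE : expansion c p j * (expansion c p j)⁻¹ = 1 := PowerSeries.mul_inv_cancel _ hj
  have h1 : ∀ i, PowerSeries.coeff 1 (expansion c p i * (expansion c p j)⁻¹) = 0 := by
    intro i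
    rcases Fin.eq_self_or_eq_succAbove j i with rfl | ⟨i, rfl⟩
    · rw [hEE]
      simp [PowerSeries.coeff_one]
    · have := h0 i
      rwa [germ, map_sub, PowerSeries.coeff_C, if_neg one_ne_zero, sub_zero] at this
  refine hs (slope c p j / value c p j) (funext fun i => ?_)
  have h2 : expansion c p i = expansion c p i * (expansion c p j)⁻¹ * expansion c p j := by
    rw [mul_assoc, mul_comm _ (expansion c p j), hEE, mul_one]
  rw [slope, h2, PowerSeries.coeff_mul]
  simp only [Finset.Nat.antidiagonal_succ, Finset.Nat.antidiagonal_zero, Finset.map_singleton,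
    Finset.sum_cons, Finset.sum_singleton, Function.Embedding.prodMap, zero_add,
    Function.Embedding.coeFn_mk, Prod.map, Nat.succ_eq_add_one, Function.Embedding.refl_apply, h1]
  simp only [zero_mul, add_zero, PowerSeries.coeff_zero_eq_constantCoeff_apply, map_mul,
    PowerSeries.constantCoeff_inv, Pi.smul_apply, smul_eq_mul]
  change value c p i * (value c p j)⁻¹ * slope c p j = slope c p j / value c p j * value c p i
  field_simp

/-- The factors `a i` in the germ `X ^ k i * a i` at the cusp. -/
def cuspFactor {d : ℕ} (m : ℕ) (c : Forms 3 d) (i : Fin 3) : PowerSeries ℂ :=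
  (PowerSeries.mk fun l =>
      PowerSeries.coeff (l + cuspOrders m i) (expansion c ((0 : ℂ) : OnePoint ℂ) i.succ)) *
    (expansion c ((0 : ℂ) : OnePoint ℂ) 0)⁻¹

/-- Away from a cusp at `0` with vanishing orders `formOrders m`, the map is an injective
immersion. -/
structure IsGood {d : ℕ} (m : ℕ) (c : Forms 3 d) : Prop where
  lt_order : ∀ (i : Fin 4) (j : Fin (d + 1)), (j : ℕ) < formOrders m i → c (i, j) = 0
  order : ∀ (i : Fin 4) (j : Fin (d + 1)), (j : ℕ) = formOrders m i → c (i, j) ≠ 0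
  value_infty : value c OnePoint.infty 1 ≠ 0
  slope_infty : ∀ r : ℂ, slope c OnePoint.infty ≠ r • value c OnePoint.infty
  value_coe : ∀ t : ℂ, t ≠ 0 → ∃ i : Fin 4, i ≠ 0 ∧ value c (t : OnePoint ℂ) i ≠ 0
  value_ne : ∀ s t : ℂ, s ≠ 0 → t ≠ 0 → s ≠ t → ∀ r : ℂ,
    value c (s : OnePoint ℂ) ≠ r • value c (t : OnePoint ℂ)
  value_ne_infty : ∀ s : ℂ, s ≠ 0 → ∀ r : ℂ,
    value c (s : OnePoint ℂ) ≠ r • value c OnePoint.infty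
  slope_ne : ∀ s : ℂ, s ≠ 0 → ∀ r : ℂ, slope c (s : OnePoint ℂ) ≠ r • value c (s : OnePoint ℂ)

namespace IsGood

variable {m d : ℕ} {c : Forms 3 d}

theorem value_zero (h : IsGood m c) (hm : m ≠ 0) {i : Fin 4} (hi : i ≠ 0) :
    value c ((0 : ℂ) : OnePoint ℂ) i = 0 := by
  rw [value, ← PowerSeries.coeff_zero_eq_constantCoeff_apply]
  refine (coeff_expansion_zero c i 0).trans ?_
  rw [dif_pos (Nat.succ_pos d)]
  refine h.lt_order i _ ?_
  fin_cases i
  · exact absurd rfl hi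
  · simpa [formOrders] using Nat.pos_of_ne_zero hm
  · simp [formOrders]
  · simp [formOrders]

theorem value_zero_zero (h : IsGood m c) : value c ((0 : ℂ) : OnePoint ℂ) 0 ≠ 0 := by
  rw [value, ← PowerSeries.coeff_zero_eq_constantCoeff_apply]
  intro h0
  have h1 := (coeff_expansion_zero c 0 0).symm.trans h0
  rw [dif_pos (Nat.succ_pos d)] at h1
  exact h.order 0 ⟨0, Nat.succ_pos d⟩ rfl h1

theorem value_ne_zero (h : IsGood m c) (p : OnePoint ℂ) : value c p ≠ 0 := by
  intro h0
  induction p using OnePoint.rec with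
  | infty => exact h.value_infty (congrFun h0 1)
  | coe z =>
    by_cases hz : z = 0
    · subst hz
      exact h.value_zero_zero (congrFun h0 0)
    · obtain ⟨i, _, hi⟩ := h.value_coe z hz
      exact hi (congrFun h0 i)

theorem linearIndependent (h : IsGood m c) (hm : m ≠ 0) (hd : 2 * m + 4 ≤ d) :
    LinearIndependent ℂ (fun (i : Fin 4) (j : Fin (d + 1)) => c (i, j)) := by
  rw [Fintype.linearIndependent_iff]
  intro g hg
  have hsum : ∀ j, g 0 * c (0, j) + g 1 * c (1, j) + g 2 * c (2, j) + g 3 * c (3, j) = 0 := by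
    intro j
    have := congrFun hg j
    simpa [Fin.sum_univ_four] using this
  have h0 : g 0 = 0 := by
    have := hsum ⟨0, by omega⟩
    rw [h.lt_order 1 _ (by simp [formOrders]; omega), h.lt_order 2 _ (by simp [formOrders]),
      h.lt_order 3 _ (by simp [formOrders])] at this
    simp only [mul_zero, add_zero] at this
    exact (mul_eq_zero.1 this).resolve_right (h.order 0 _ rfl)
  have h1 : g 1 = 0 := by
    have := hsum ⟨2 * m, by omega⟩
    rw [h0, h.lt_order 2 _ (by simp [formOrders]), h.lt_order 3 _ (by simp [formOrders])] at this
    simp only [mul_zero, zero_mul, add_zero, zero_add] at this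
    exact (mul_eq_zero.1 this).resolve_right (h.order 1 _ rfl)
  have h2 : g 2 = 0 := by
    have := hsum ⟨2 * m + 2, by omega⟩
    rw [h0, h1, h.lt_order 3 _ (by simp [formOrders])] at this
    simp only [mul_zero, zero_mul, add_zero, zero_add] at this
    exact (mul_eq_zero.1 this).resolve_right (h.order 2 _ rfl)
  have h3 : g 3 = 0 := by
    have := hsum ⟨2 * m + 4, by omega⟩
    rw [h0, h1, h2] at this
    simp only [zero_mul, zero_add] at this
    exact (mul_eq_zero.1 this).resolve_right (h.order 3 _ rfl)
  intro i
  fin_cases i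
  exacts [h0, h1, h2, h3]

theorem value_not_proportional (h : IsGood m c) (hm : m ≠ 0) {p q : OnePoint ℂ} (hpq : p ≠ q)
    (r : ℂ) : value c p ≠ r • value c q := by
  have hsymm : ∀ {p q : OnePoint ℂ}, (∀ r : ℂ, value c p ≠ r • value c q) →
      ∀ r : ℂ, value c q ≠ r • value c p := by
    intro p q hne r hr
    have hr0 : r ≠ 0 := fun h0 => h.value_ne_zero q (by rw [hr, h0, zero_smul])
    exact hne r⁻¹ (by rw [hr, smul_smul, inv_mul_cancel₀ hr0, one_smul])
  have hcoe : ∀ t : ℂ, t ≠ 0 → ∀ r : ℂ,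
      value c (t : OnePoint ℂ) ≠ r • value c ((0 : ℂ) : OnePoint ℂ) := by
    intro t ht r hr
    obtain ⟨i, hi, hne⟩ := h.value_coe t ht
    refine hne ?_
    rw [hr, Pi.smul_apply, h.value_zero hm hi, smul_zero]
  have hinf : ∀ r : ℂ, value c OnePoint.infty ≠ r • value c ((0 : ℂ) : OnePoint ℂ) := by
    intro r hr
    refine h.value_infty ?_
    rw [hr, Pi.smul_apply, h.value_zero hm (by decide), smul_zero]
  induction p using OnePoint.rec with
  | infty =>
    induction q using OnePoint.rec with
    | infty => exact absurd rfl hpq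
    | coe t =>
      by_cases ht : t = 0
      · subst ht
        exact hinf r
      · exact hsymm (h.value_ne_infty t ht) r
  | coe s =>
    induction q using OnePoint.rec with
    | infty =>
      by_cases hs : s = 0
      · subst hs
        exact hsymm hinf r
      · exact h.value_ne_infty s hs r
    | coe t =>
      have hst : s ≠ t := fun h => hpq (congrArg _ h)
      by_cases hs : s = 0
      · subst hs
        exact hsymm (hcoe t hst.symm) r
      · by_cases ht : t = 0
        · subst ht
          exact hcoe s hs r
        · exact h.value_ne s t hs ht hst r

theorem germ_zero (h : IsGood m c) (hm : m ≠ 0) :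
    germ c ((0 : ℂ) : OnePoint ℂ) 0 = fun i => PowerSeries.X ^ cuspOrders m i * cuspFactor m c i := by
  funext i
  have hE : expansion c ((0 : ℂ) : OnePoint ℂ) i.succ = PowerSeries.X ^ cuspOrders m i *
      PowerSeries.mk fun l => PowerSeries.coeff (l + cuspOrders m i)
        (expansion c ((0 : ℂ) : OnePoint ℂ) i.succ) := by
    ext l
    rw [PowerSeries.coeff_X_pow_mul']
    split_ifs with hl
    · rw [PowerSeries.coeff_mk, Nat.sub_add_cancel hl]
    · rw [coeff_expansion_zero]
      split_ifs with hld
      · refine h.lt_order i.succ ⟨l, hld⟩ ?_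
        rw [not_le] at hl
        exact hl
      · rfl
  rw [germ, Fin.succAbove_zero, h.value_zero hm (Fin.succ_ne_zero i), zero_mul, map_zero, sub_zero,
    hE, cuspFactor, mul_assoc]

theorem constantCoeff_cuspFactor (h : IsGood m c) (hd : 2 * m + 4 ≤ d) (i : Fin 3) :
    PowerSeries.constantCoeff (cuspFactor m c i) ≠ 0 := by
  rw [cuspFactor, map_mul, PowerSeries.constantCoeff_inv]
  refine mul_ne_zero ?_ (inv_ne_zero h.value_zero_zero)
  rw [← PowerSeries.coeff_zero_eq_constantCoeff_apply, PowerSeries.coeff_mk, zero_add,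
    coeff_expansion_zero, dif_pos]
  · exact h.order i.succ _ rfl
  · fin_cases i <;> simp [cuspOrders] <;> omega

theorem mem_severi (h : IsGood m c) (hm : m ≠ 0) (hd : 2 * m + 4 ≤ d) {S : Set ℕ} {g : ℕ}
    (hS : valueSemigroup (fun i => PowerSeries.X ^ cuspOrders m i * cuspFactor m c i) = S)
    (hfin : Sᶜ.Finite) (hg : g = Sᶜ.ncard) (hg0 : g ≠ 0) : c ∈ severi 3 d g S := by
  have hM : c ∈ maps 3 d := ⟨h.value_ne_zero, h.linearIndependent hm hd⟩
  have h0 : valueSemigroupAt c ((0 : ℂ) : OnePoint ℂ) = S := by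
    rw [valueSemigroupAt_eq c _ h.value_zero_zero, h.germ_zero hm, hS]
  have hq : ∀ q : OnePoint ℂ, q ≠ ((0 : ℂ) : OnePoint ℂ) → valueSemigroupAt c q = Set.univ := by
    intro q hq
    refine valueSemigroupAt_eq_univ (h.value_ne_zero q) ?_
    induction q using OnePoint.rec with
    | infty => exact h.slope_infty
    | coe z => exact h.slope_ne z fun hz => hq (congrArg _ hz)
  refine ⟨hM, fun p q hpq => ?_, ?_, _, h0, ?_, hq⟩
  · rw [toMap, toMap, Projectivization.mk_eq_mk_iff'] at hpq
    obtain ⟨r, hr⟩ := hpq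
    by_contra hne
    exact h.value_not_proportional hm hne r hr.symm
  · rw [arithGenus, finsum_eq_single _ ((0 : ℂ) : OnePoint ℂ), h0, hg, hfin.cast_ncard_eq]
    intro q hne
    rw [hq q hne, Set.compl_univ, Set.encard_empty]
  · rintro rfl
    rw [Set.compl_univ, Set.ncard_empty] at hg
    exact hg0 hg

end IsGood

theorem formOrders_le (m : ℕ) (i : Fin 4) : formOrders m i ≤ 2 * m + 4 := by
  fin_cases i <;> simp [formOrders]

/-- The forms with vanishing orders `formOrders m` at `0` are generically good. -/
theorem exists_isGood_mask {m d : ℕ} (hd : 2 * m + 5 ≤ d) :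
    ∃ Ψ : MvPolynomial (Fin 4 × Fin (d + 1)) ℂ, Ψ ≠ 0 ∧ ∀ x : Forms 3 d,
      MvPolynomial.eval x Ψ ≠ 0 → IsGood m (mask (formOrders m) x) := by
  let D : Fin (d + 1) := Fin.last d
  let D' : Fin (d + 1) := ⟨d - 1, by omega⟩
  have hDk : ∀ i, formOrders m i ≤ (D : ℕ) := fun i => (formOrders_le m i).trans (by
    simp only [D, Fin.val_last]; omega)
  have hDk' : ∀ i, formOrders m i ≤ (D' : ℕ) := fun i => (formOrders_le m i).trans (by
    simp only [D']; omega)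
  have hmD : ∀ (x : Forms 3 d) i, mask (formOrders m) x (i, D) = x (i, D) := fun x i =>
    if_pos (hDk i)
  have hmD' : ∀ (x : Forms 3 d) i, mask (formOrders m) x (i, D') = x (i, D') := fun x i =>
    if_pos (hDk' i)
  have hvI : ∀ (x : Forms 3 d) i, value (mask (formOrders m) x) OnePoint.infty i = x (i, D) := by
    intro x i
    rw [value, ← PowerSeries.coeff_zero_eq_constantCoeff_apply]
    exact (coeff_expansion_infty _ i (Nat.zero_le d)).trans (hmD x i)
  have hsI : ∀ (x : Forms 3 d) i, slope (mask (formOrders m) x) OnePoint.infty i = x (i, D') := by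
    intro x i
    exact (coeff_expansion_infty _ i (by omega)).trans (hmD' x i)
  let w₂ : Fin (d + 1) → MvPolynomial (Fin 3) ℂ := fun j =>
    MvPolynomial.X 0 ^ (j : ℕ) - MvPolynomial.X 2 * MvPolynomial.X 1 ^ (j : ℕ)
  let w₄ : Fin (d + 1) → MvPolynomial (Fin 2) ℂ := fun j =>
    MvPolynomial.C ((j : ℕ) : ℂ) * MvPolynomial.X 0 ^ ((j : ℕ) - 1) -
      MvPolynomial.X 1 * MvPolynomial.X 0 ^ (j : ℕ)
  obtain ⟨Ψ₁, h₁, H₁⟩ := exists_eval_eq_zero_of_incidence (formOrders m) {1, 2, 3}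
    (r := 1) (by decide) (fun j => MvPolynomial.X 0 ^ (j : ℕ)) D (fun i _ => hDk i)
  obtain ⟨Ψ₂, h₂, H₂⟩ := exists_eval_eq_zero_of_incidence (formOrders m) Finset.univ
    (by simp) w₂ D (fun i _ => hDk i)
  obtain ⟨Ψ₂', h₂', H₂'⟩ := exists_eval_eq_zero_of_incidence (formOrders m) Finset.univ
    (by simp) w₂ D' (fun i _ => hDk' i)
  obtain ⟨Ψ₃, h₃, H₃⟩ := exists_eval_eq_zero_of_incidence (formOrders m) Finset.univ
    (r := 2) (by simp) (fun j => MvPolynomial.X 0 ^ (j : ℕ) -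
      MvPolynomial.X 1 * MvPolynomial.C (if j = D then 1 else 0)) D' (fun i _ => hDk' i)
  obtain ⟨Ψ₄, h₄, H₄⟩ := exists_eval_eq_zero_of_incidence (formOrders m) Finset.univ
    (by simp) w₄ D (fun i _ => hDk i)
  obtain ⟨Ψ₄', h₄', H₄'⟩ := exists_eval_eq_zero_of_incidence (formOrders m) Finset.univ
    (by simp) w₄ D' (fun i _ => hDk' i)
  let Ψ₅ : MvPolynomial (Fin 4 × Fin (d + 1)) ℂ :=
    MvPolynomial.X (0, D) * MvPolynomial.X (1, D') - MvPolynomial.X (0, D') * MvPolynomial.X (1, D)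
  have hDD : D' ≠ D := by
    intro h
    have := congrArg Fin.val h
    simp only [D, D', Fin.val_last] at this
    omega
  have h₅ : Ψ₅ ≠ 0 := by
    intro h
    have := congrArg (MvPolynomial.eval fun s : Fin 4 × Fin (d + 1) =>
      if s = (0, D) ∨ s = (1, D') then 1 else 0) h
    simp [Ψ₅, hDD] at this
  let Ψ₆ : MvPolynomial (Fin 4 × Fin (d + 1)) ℂ :=
    ∏ i, MvPolynomial.X (i, Fin.ofNat (d + 1) (formOrders m i))
  have h₆ : Ψ₆ ≠ 0 := Finset.prod_ne_zero_iff.2 fun i _ => MvPolynomial.X_ne_zero _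
  refine ⟨Ψ₁ * (Ψ₂ * Ψ₂') * Ψ₃ * (Ψ₄ * Ψ₄') * Ψ₅ * Ψ₆ * MvPolynomial.X (1, D), ?_, fun x hx => ?_⟩
  · exact mul_ne_zero (mul_ne_zero (mul_ne_zero (mul_ne_zero (mul_ne_zero (mul_ne_zero h₁
      (mul_ne_zero h₂ h₂')) h₃) (mul_ne_zero h₄ h₄')) h₅) h₆) (MvPolynomial.X_ne_zero _)
  simp only [map_mul, mul_ne_zero_iff, MvPolynomial.eval_X] at hx
  obtain ⟨⟨⟨⟨⟨⟨x₁, x₂, x₂'⟩, x₃⟩, x₄, x₄'⟩, x₅⟩, x₆⟩, x₇⟩ := hx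
  have hinv : ∀ {s : ℂ} (_ : s ≠ 0) (a b : ℂ), s ^ d = a * b ^ d → s ^ (d - 1) = a * b ^ (d - 1) →
      s = b := by
    intro s hs a b e1 e2
    obtain ⟨l, rfl⟩ : ∃ l, d = l + 1 := ⟨d - 1, by omega⟩
    rw [Nat.add_sub_cancel] at e2
    have : s ^ l * (s - b) = 0 := by
      rw [mul_sub, ← pow_succ, e1, e2]
      ring
    exact sub_eq_zero.1 ((mul_eq_zero.1 this).resolve_left (pow_ne_zero l hs))
  constructor
  · intro i j hj
    exact if_neg (not_le.2 hj)
  · intro i j hj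
    simp only [mask]
    rw [if_pos hj.ge]
    have h6 := Finset.prod_ne_zero_iff.1 (by rwa [map_prod] at x₆) i (Finset.mem_univ i)
    have hj' : Fin.ofNat (d + 1) (formOrders m i) = j := by
      rw [← hj]
      exact Fin.ext (Nat.mod_eq_of_lt j.2)
    rwa [MvPolynomial.eval_X, hj'] at h6
  · rw [hvI]
    exact x₇
  · intro r hr
    refine x₅ ?_
    have h0 := congrFun hr 0
    have h1 := congrFun hr 1
    rw [Pi.smul_apply, hvI, hsI, smul_eq_mul] at h0 h1
    simp only [Ψ₅, map_sub, map_mul, MvPolynomial.eval_X, h0, h1]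
    ring
  · intro t ht
    by_contra! hne
    refine x₁ (H₁ x (fun _ => t) (by simpa using fun h => absurd h ht) fun i hi => ?_)
    have hi0 : i ≠ 0 := by
      rintro rfl
      revert hi
      decide
    rw [← hne i hi0, value_coe]
    simp
  · intro s t hs ht hst r hr
    have hrow : ∀ i ∈ (Finset.univ : Finset (Fin 4)), ∑ j, mask (formOrders m) x (i, j) *
        MvPolynomial.eval ![s, t, r] (w₂ j) = 0 := by
      intro i _
      have h1 := congrFun hr i
      rw [Pi.smul_apply, value_coe, value_coe, smul_eq_mul, ← sub_eq_zero, Finset.mul_sum,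
        ← Finset.sum_sub_distrib] at h1
      rw [← h1]
      refine Finset.sum_congr rfl fun j _ => ?_
      simp [w₂]
      ring
    by_cases hp : MvPolynomial.eval ![s, t, r] (w₂ D) = 0
    · refine x₂' (H₂' x ![s, t, r] (fun hp' => hst ?_) hrow)
      simp only [w₂, D, D', map_sub, map_mul, map_pow, MvPolynomial.eval_X, Matrix.cons_val,
        Fin.val_last, sub_eq_zero] at hp hp'
      exact hinv hs r t hp hp'
    · exact x₂ (H₂ x ![s, t, r] hp hrow)
  · intro s hs r hr
    refine x₃ (H₃ x ![s, r] ?_ fun i _ => ?_)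
    · simp [hDD, hs]
    · have h1 := congrFun hr i
      rw [Pi.smul_apply, value_coe, hvI, smul_eq_mul, ← sub_eq_zero] at h1
      refine Eq.trans ?_ h1
      simp only [map_sub, map_mul, map_pow, MvPolynomial.eval_X, MvPolynomial.eval_C,
        Matrix.cons_val, mul_sub, Finset.sum_sub_distrib, mul_ite, mul_one, mul_zero,
        Finset.sum_ite_eq', Finset.mem_univ, if_true, hmD]
      ring
  · intro s hs r hr
    have hrow : ∀ i ∈ (Finset.univ : Finset (Fin 4)), ∑ j, mask (formOrders m) x (i, j) *
        MvPolynomial.eval ![s, r] (w₄ j) = 0 := by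
      intro i _
      have h1 := congrFun hr i
      rw [Pi.smul_apply, value_coe, slope_coe, smul_eq_mul, ← sub_eq_zero, Finset.mul_sum,
        ← Finset.sum_sub_distrib] at h1
      rw [← h1]
      refine Finset.sum_congr rfl fun j _ => ?_
      simp [w₄]
      ring
    by_cases hp : MvPolynomial.eval ![s, r] (w₄ D) = 0
    · refine x₄' (H₄' x ![s, r] (fun hp' => ?_) hrow)
      simp only [w₄, D, D', map_sub, map_mul, map_pow, MvPolynomial.eval_X, MvPolynomial.eval_C,
        Matrix.cons_val, Fin.val_last] at hp hp'
      obtain ⟨l, rfl⟩ : ∃ l, d = l + 2 := ⟨d - 2, by omega⟩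
      rw [show l + 2 - 1 = l + 1 by omega] at hp hp'
      rw [Nat.add_sub_cancel] at hp'
      have h2 : s ^ (l + 1) = 0 := by
        push_cast at hp hp'
        linear_combination hp - s * hp'
      exact hs (pow_eq_zero_iff (by omega) |>.1 h2)
    · exact x₄ (H₄ x ![s, r] hp hrow)

theorem eval_aeval_line {σ : Type*} (b v : σ → ℂ) (h : MvPolynomial σ ℂ) (r : ℂ) :
    Polynomial.eval r (MvPolynomial.aeval
      (fun s => Polynomial.C (b s) + Polynomial.X * Polynomial.C (v s)) h) =
      MvPolynomial.eval (fun s => b s + r * v s) h := by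
  induction h using MvPolynomial.induction_on with
  | C a => simp
  | add p q hp hq => rw [map_add, map_add, Polynomial.eval_add, hp, hq]
  | mul_X p s hp =>
    rw [map_mul, Polynomial.eval_mul, hp, map_mul, MvPolynomial.aeval_X, MvPolynomial.eval_X]
    simp [mul_comm r]

/-- If two polynomials do not vanish identically on two lines, there is a common parameter at
which neither vanishes. -/
theorem exists_line_eval_ne_zero {σ τ : Type*} {h : MvPolynomial σ ℂ} {Φ : MvPolynomial τ ℂ}
    (b v : σ → ℂ) (b' v' : τ → ℂ) (hb : MvPolynomial.eval b h ≠ 0)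
    (hb' : MvPolynomial.eval (fun s => b' s + v' s) Φ ≠ 0) :
    ∃ r : ℂ, MvPolynomial.eval (fun s => b s + r * v s) h ≠ 0 ∧
      MvPolynomial.eval (fun s => b' s + r * v' s) Φ ≠ 0 := by
  simp_rw [← eval_aeval_line]
  set p := MvPolynomial.aeval
    (fun s => Polynomial.C (b s) + Polynomial.X * Polynomial.C (v s)) h with hp
  set q := MvPolynomial.aeval
    (fun s => Polynomial.C (b' s) + Polynomial.X * Polynomial.C (v' s)) Φ with hq
  have hp0 : p ≠ 0 := by
    intro h0
    have := eval_aeval_line b v h 0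
    rw [← hp, h0] at this
    exact hb (by simpa using this.symm)
  have hq0 : q ≠ 0 := by
    intro h0
    have := eval_aeval_line b' v' Φ 1
    rw [← hq, h0] at this
    exact hb' (by simpa using this.symm)
  by_contra! hall
  refine mul_ne_zero hp0 hq0 (Polynomial.funext fun r => ?_)
  rw [Polynomial.eval_mul, Polynomial.eval_zero]
  by_cases h0 : Polynomial.eval r p = 0
  · rw [h0, zero_mul]
  · rw [hall r h0, mul_zero]

theorem coeffEval_congr {n N : ℕ} {Φ : MvPolynomial (Fin n × ℕ) ℂ}
    (hN : ∀ v ∈ Φ.vars, v.2 ≤ N) {a a' : Fin n → PowerSeries ℂ}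
    (h : ∀ i, ∀ l ≤ N, PowerSeries.coeff l (a i) = PowerSeries.coeff l (a' i)) :
    coeffEval a Φ = coeffEval a' Φ :=
  MvPolynomial.eval₂Hom_congr' rfl (fun v hv _ => h v.1 v.2 (hN v hv)) rfl

theorem expansion_zero_row_eq {m d : ℕ} {x y : Forms 3 d} {i : Fin 4}
    (h : ∀ j, x (i, j) = y (i, j)) :
    expansion (mask (formOrders m) x) ((0 : ℂ) : OnePoint ℂ) i =
      expansion (mask (formOrders m) y) ((0 : ℂ) : OnePoint ℂ) i := by
  rw [expansion_eq_sum, expansion_eq_sum]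
  refine Finset.sum_congr rfl fun j _ => ?_
  simp only [mask, h]

/-- The factors at the cusp depend linearly on the rows `1`, `2`, `3`. -/
theorem cuspFactor_line {m d : ℕ} {x y : Forms 3 d} (h : ∀ j, x (0, j) = y (0, j)) (r : ℂ)
    (i : Fin 3) :
    cuspFactor m (mask (formOrders m) fun s => x s + r * (y s - x s)) i =
      cuspFactor m (mask (formOrders m) x) i +
        PowerSeries.C r * (cuspFactor m (mask (formOrders m) y) i -
          cuspFactor m (mask (formOrders m) x) i) := by
  have h0 : expansion (mask (formOrders m) fun s => x s + r * (y s - x s))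
      ((0 : ℂ) : OnePoint ℂ) 0 = expansion (mask (formOrders m) x) ((0 : ℂ) : OnePoint ℂ) 0 :=
    expansion_zero_row_eq fun j => by rw [h j]; ring
  have h1 : expansion (mask (formOrders m) y)
      ((0 : ℂ) : OnePoint ℂ) 0 = expansion (mask (formOrders m) x) ((0 : ℂ) : OnePoint ℂ) 0 :=
    expansion_zero_row_eq fun j => (h j).symm
  have h2 : (PowerSeries.mk fun l => PowerSeries.coeff (l + cuspOrders m i)
      (expansion (mask (formOrders m) fun s => x s + r * (y s - x s))
        ((0 : ℂ) : OnePoint ℂ) i.succ)) =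
      (PowerSeries.mk fun l => PowerSeries.coeff (l + cuspOrders m i)
        (expansion (mask (formOrders m) x) ((0 : ℂ) : OnePoint ℂ) i.succ)) +
      PowerSeries.C r * ((PowerSeries.mk fun l => PowerSeries.coeff (l + cuspOrders m i)
        (expansion (mask (formOrders m) y) ((0 : ℂ) : OnePoint ℂ) i.succ)) -
        PowerSeries.mk fun l => PowerSeries.coeff (l + cuspOrders m i)
          (expansion (mask (formOrders m) x) ((0 : ℂ) : OnePoint ℂ) i.succ)) := by
    ext l
    simp only [map_add, map_sub, PowerSeries.coeff_C_mul, PowerSeries.coeff_mk,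
      coeff_expansion_zero, mask]
    split_ifs <;> ring
  simp only [cuspFactor]
  rw [h0, h1, h2]
  ring

/-- The forms with the first row `x (0, ·)` and prescribed factors at the cusp, up to the
degree `d`. -/
def formsOfFactors {d : ℕ} (m : ℕ) (x : Forms 3 d) (a : Fin 3 → PowerSeries ℂ) : Forms 3 d :=
  fun s => (Fin.cons (x (0, s.2)) fun i => PowerSeries.coeff s.2
    (PowerSeries.X ^ cuspOrders m i *
      (expansion (mask (formOrders m) x) ((0 : ℂ) : OnePoint ℂ) 0 * a i)) : Fin 4 → ℂ) s.1

theorem coeff_cuspFactor_formsOfFactors {m d : ℕ} {x : Forms 3 d} (a : Fin 3 → PowerSeries ℂ)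
    (hx : PowerSeries.constantCoeff
      (expansion (mask (formOrders m) x) ((0 : ℂ) : OnePoint ℂ) 0) ≠ 0)
    (i : Fin 3) {N l : ℕ} (hN : N + 2 * m + 4 ≤ d) (hl : l ≤ N) :
    PowerSeries.coeff l (cuspFactor m (mask (formOrders m) (formsOfFactors m x a)) i) =
      PowerSeries.coeff l (a i) := by
  set E := expansion (mask (formOrders m) x) ((0 : ℂ) : OnePoint ℂ) 0 with hEdef
  have h0 : expansion (mask (formOrders m) (formsOfFactors m x a)) ((0 : ℂ) : OnePoint ℂ) 0 = E :=
    expansion_zero_row_eq fun j => rfl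
  have hk : cuspOrders m i ≤ 2 * m + 4 := formOrders_le m i.succ
  have h1 : PowerSeries.X ^ (N + 1) ∣ (PowerSeries.mk fun l => PowerSeries.coeff
      (l + cuspOrders m i) (expansion (mask (formOrders m) (formsOfFactors m x a))
        ((0 : ℂ) : OnePoint ℂ) i.succ)) - E * a i := by
    rw [PowerSeries.X_pow_dvd_iff]
    intro j hj
    have hcoeff : mask (formOrders m) (formsOfFactors m x a)
        (i.succ, ⟨j + cuspOrders m i, by omega⟩) = PowerSeries.coeff (j + cuspOrders m i)
          (PowerSeries.X ^ cuspOrders m i * (E * a i)) :=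
      if_pos (show cuspOrders m i ≤ j + cuspOrders m i from Nat.le_add_left _ _)
    rw [map_sub, PowerSeries.coeff_mk, coeff_expansion_zero, dif_pos (by omega), hcoeff,
      PowerSeries.coeff_X_pow_mul, sub_self]
  have h2 : PowerSeries.X ^ (N + 1) ∣
      cuspFactor m (mask (formOrders m) (formsOfFactors m x a)) i - a i := by
    have : cuspFactor m (mask (formOrders m) (formsOfFactors m x a)) i - a i =
        ((PowerSeries.mk fun l => PowerSeries.coeff
          (l + cuspOrders m i) (expansion (mask (formOrders m) (formsOfFactors m x a))
            ((0 : ℂ) : OnePoint ℂ) i.succ)) - E * a i) * E⁻¹ := by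
      rw [cuspFactor, h0, sub_mul]
      congr 1
      rw [mul_comm E, mul_assoc, PowerSeries.mul_inv_cancel _ hx, mul_one]
    rw [this]
    exact h1.mul_right _
  have h3 := PowerSeries.X_pow_dvd_iff.1 h2 l (Nat.lt_succ_of_le hl)
  rwa [map_sub, sub_eq_zero] at h3

/-- The Severi variety is dense in the space of forms with vanishing orders `formOrders m`. -/
theorem exists_mask_mem_severi {m : ℕ} (hm : m ≠ 0) {S : Set ℕ}
    (hS : IsGenericValueSemigroup (cuspOrders m) S) (hS0 : Sᶜ.ncard ≠ 0) :
    ∃ D : ℕ, 2 * m + 5 ≤ D ∧ ∀ d, D ≤ d → ∀ h : MvPolynomial (Fin 4 × Fin (d + 1)) ℂ, h ≠ 0 →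
      ∃ x : Forms 3 d, MvPolynomial.eval x h ≠ 0 ∧
        mask (formOrders m) x ∈ severi 3 d Sᶜ.ncard S := by
  have hfin := finite_compl_of_isGeneric hm hS
  obtain ⟨Φ, hΦ, hgen⟩ := hS
  obtain ⟨N, hN⟩ : ∃ N, ∀ v ∈ Φ.vars, v.2 ≤ N :=
    ⟨Φ.vars.sup Prod.snd, fun v hv => Finset.le_sup (f := Prod.snd) hv⟩
  refine ⟨N + 2 * m + 5, by omega, fun d hd h hh => ?_⟩
  obtain ⟨Ψ, hΨ, hgood⟩ := exists_isGood_mask (m := m) (d := d) (by omega)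
  obtain ⟨a, ha, hΦa⟩ := exists_coeffEval_ne_zero hΦ
  obtain ⟨x, hx⟩ : ∃ x : Forms 3 d, MvPolynomial.eval x (h * Ψ) ≠ 0 := by
    by_contra! hall
    exact mul_ne_zero hh hΨ (MvPolynomial.funext fun x => by rw [hall x, map_zero])
  have hx0 : PowerSeries.constantCoeff
      (expansion (mask (formOrders m) x) ((0 : ℂ) : OnePoint ℂ) 0) ≠ 0 := by
    rw [map_mul] at hx
    exact (hgood x (right_ne_zero_of_mul hx)).value_zero_zero
  let y := formsOfFactors m x a
  have hy : ∀ j, x (0, j) = y (0, j) := fun j => rfl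
  have hΦy : coeffEval (cuspFactor m (mask (formOrders m) y)) Φ ≠ 0 := by
    rwa [coeffEval_congr hN fun i l hl =>
      coeff_cuspFactor_formsOfFactors a hx0 i (by omega) hl]
  obtain ⟨r, hr1, hr2⟩ := exists_line_eval_ne_zero (h := h * Ψ) (Φ := Φ) x (fun s => y s - x s)
    (fun v => PowerSeries.coeff v.2 (cuspFactor m (mask (formOrders m) x) v.1))
    (fun v => PowerSeries.coeff v.2 (cuspFactor m (mask (formOrders m) y) v.1) -
      PowerSeries.coeff v.2 (cuspFactor m (mask (formOrders m) x) v.1)) hx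
    (by simp only [add_sub_cancel]; exact hΦy)
  rw [map_mul] at hr1
  have hg := hgood _ (right_ne_zero_of_mul hr1)
  refine ⟨_, left_ne_zero_of_mul hr1, hg.mem_severi hm (by omega) ?_ hfin rfl hS0⟩
  refine hgen _ (hg.constantCoeff_cuspFactor (by omega)) ?_
  convert hr2 using 3
  funext v
  rw [cuspFactor_line hy, map_add, PowerSeries.coeff_C_mul, map_sub]

theorem codim_severi_le {m : ℕ} (hm : m ≠ 0) {S : Set ℕ}
    (hS : IsGenericValueSemigroup (cuspOrders m) S) (hS0 : Sᶜ.ncard ≠ 0) :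
    ∃ D : ℕ, ∀ d, D ≤ d → codim (severi 3 d Sᶜ.ncard S) (maps 3 d) ≤ (6 * m : ℕ) := by
  obtain ⟨D, hD, h⟩ := exists_mask_mem_severi hm hS hS0
  refine ⟨D, fun d hd => codim_le_of_dense hm (by omega) (fun c hc => hc.1)
    (fun A B hBA c hc => act_mem_severi hBA hc) (h d hd)⟩

end

end Severi

theorem corollary3p17 :
    ∃ D : ℕ → ℕ, ∀ m : ℕ, 9 ≤ m →
      (∃! S : Set ℕ, Severi.IsGenericValueSemigroup ![2 * m, 2 * m + 2, 2 * m + 4] S) ∧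
      ∀ S : Set ℕ, Severi.IsGenericValueSemigroup ![2 * m, 2 * m + 2, 2 * m + 4] S →
        Sᶜ.Finite ∧
        ∀ g : ℕ, g = Sᶜ.ncard → ∀ d : ℕ, D g ≤ d →
          Severi.codim (Severi.severi 3 d g S) (Severi.maps 3 d) < (g : ℕ∞) := by
  have hD : ∀ m : ℕ, ∃ D : ℕ, 9 ≤ m → ∀ S : Set ℕ,
      Severi.IsGenericValueSemigroup (Severi.cuspOrders m) S → ∀ d, D ≤ d →
      Severi.codim (Severi.severi 3 d Sᶜ.ncard S) (Severi.maps 3 d) ≤ (6 * m : ℕ) := by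
    intro m
    by_cases hm : 9 ≤ m
    · have hm0 : m ≠ 0 := by omega
      obtain ⟨S, hS⟩ := Severi.exists_isGenericValueSemigroup_cuspOrders hm0
      have hg := Severi.le_ncard_compl_of_isGeneric hm0 hS
      obtain ⟨D, hD⟩ := Severi.codim_severi_le hm0 hS (by omega)
      refine ⟨D, fun _ S' hS' d hd => ?_⟩
      rw [← hS.unique hS']
      exact hD d hd
    · exact ⟨0, fun h => absurd h hm⟩
  choose D hD using hD
  refine ⟨fun g => (Finset.range (g + 1)).sup D, fun m hm => ?_⟩
  have hm0 : m ≠ 0 := by omega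
  change (∃! S, Severi.IsGenericValueSemigroup (Severi.cuspOrders m) S) ∧
    ∀ S, Severi.IsGenericValueSemigroup (Severi.cuspOrders m) S → _
  obtain ⟨S, hS⟩ := Severi.exists_isGenericValueSemigroup_cuspOrders hm0
  refine ⟨⟨S, hS, fun S' hS' => hS'.unique hS⟩, fun S' hS' =>
    ⟨Severi.finite_compl_of_isGeneric hm0 hS', ?_⟩⟩
  rintro g rfl d hd
  have hg := Severi.le_ncard_compl_of_isGeneric hm0 hS'
  have hDm : D m ≤ d :=
    (Finset.le_sup (f := D) (Finset.mem_range.2 (by omega))).trans hd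
  refine (hD m hm S' hS' d hDm).trans_lt ?_
  exact_mod_cast (show 6 * m < S'ᶜ.ncard by omega)
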